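/- **Setting.** $\log$ is the logarithm to base $2$, $\Delta_d$ the probability simplex in $\mathbb{R}^d$, $a\vee b=\max\{a,b\}$, $H(p)=-\sum_i p_i\log p_i$. Let $N\ge 2$, let $W\in\mathbb{R}^{N\times M}$ be the transition matrix of a discrete memoryless channel with input alphabet $\{1,\dots,N\}$ and output alphabet $\{1,\dots,M\}$ (rows sum to $1$), and let $\gamma>0$ satisfy $W_{ij}\ge\gamma$ for all $i,j$ (e.g. $\gamma=\min_{i,j}W_{ij}$). Put $r_i=-\sum_j W_{ij}\log W_{ij}$ and $I(p,W)=\sum_{i,j}p_iW_{ij}\log\frac{W_{ij}}{(W^\top p)_j}$. Let $P$ be either $\Delta_N$ (no cost constraint) or a nonempty set $\{p\in\Delta_N: s^\top p=S\}$ with $s\in\mathbb{R}^N$, $S\in\mathbb{R}$. For a cost vector $s$ and budget $S$ let $C_S(W)=\max\{I(p,W):p\in\Delta_N,\ s^\top p\le S\}$, and let $S_{\max}$ be the minimum of $s^\top p$ over all maximizers $p$ of $I(\cdot,W)$ on $\Delta_N$. We say that $P$ *represents* the problem $C_S(W)$ if either $S<S_{\max}$ and $P=\{p\in\Delta_N:s^\top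 p=S\}$, or $S\ge S_{\max}$ and $P=\Delta_N$. (The case $s=0$, $S=0$, $P=\Delta_N$ is the unconstrained capacity.) For $\lambda\in\mathbb{R}^M$ and $\nu>0$ let $$F(\lambda)=\max_{q\in\Delta_M}\{H(q)-\lambda^\top q\},\qquad G(\lambda)=\max_{p\in P}\{-r^\top p+\lambda^\top W^\top p\},$$ $$G_\nu(\lambda)=\max_{p\in P}\{-r^\top p+\lambda^\top W^\top p+\nu H(p)-\nu\log N\},$$ and let $p_\nu(\lambda)$ be the unique maximizer in $G_\nu(\lambda)$. The dual problem is to minimize $F+G$ over $\mathbb{R}^M$. Let $R=M\left(\log(1/\gamma)\vee\frac1{\ln 2}\right)$, $Q=\{\lambda\in\mathbb{R}^M:\|\lambda\|_2\le R\}$, $\pi_Q$ the Euclidean projection onto $Q$, $$D_1=\tfrac12\left(\left(M\log\tfrac1\gamma\right)\vee\tfrac1{\ln2}\right)^2,\qquad D_2=\log N.$$ **Algorithm.** Given $n\in\{0,1,2,\dots\}$, set $\nu=\frac{2}{n+1}\sqrt{D_1/D_2}$ and $L_\nu=1+\frac1\nu$. Start from any $x_0\in Q$, and for $k=0,1,\dots,n$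 put $g_k=\nabla F(x_k)+\nabla G_\nu(x_k)$, $$y_k=\pi_Q\left(x_k-\tfrac1{L_\nu}g_k\right),\quad z_k=\pi_Q\left(-\tfrac1{L_\nu}\sum_{i=0}^k\tfrac{i+1}2 g_i\right),\quad x_{k+1}=\tfrac2{k+3}z_k+\tfrac{k+1}{k+3}y_k .$$ The output is $\hat\lambda=y_n$ and $\hat p=\sum_{k=0}^n\frac{2(k+1)}{(n+1)(n+2)}\,p_\nu(x_k)$. **Theorem.** 1. For all $n$ and all $x_0\in Q$: $\hat\lambda\in Q$, $\hat p\in P\subseteq\Delta_N$, and $$0\le F(\hat\lambda)+G(\hat\lambda)-I(\hat p,W)\le\frac{4}{n+1}\sqrt{D_1D_2}+\frac{4D_1}{(n+1)^2}.$$ 2. For every $\varepsilon>0$ there is an integer $n_0\ge 0$ with $n_0\le 4\sqrt{D_1D_2}\,\frac1\varepsilon+2\sqrt{\frac{D_1}{\varepsilon}}$ such that for all $n\ge n_0$ and all $x_0\in Q$ the output is an $\varepsilon$-solution: $\hat p\in P$, $F(\hat\lambda)+G(\hat\lambda)-I(\hat p,W)\le\varepsilon$, $F(\hat\lambda)+G(\hat\lambda)\le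 F(\lambda)+G(\lambda)+\varepsilon$ for all $\lambda\in\mathbb{R}^M$, $I(p,W)\le I(\hat p,W)+\varepsilon$ for all $p\in P$, and, for every capacity problem $C_S(W)$ that $P$ represents, $I(\hat p,W)\le C_S(W)\le F(\hat\lambda)+G(\hat\lambda)$, where both outer terms differ from $C_S(W)$ by at most $\varepsilon$. 3. Count as one operation each natural-number constant, $+,-,\cdot,/$, $\max$, $\sqrt{\cdot}$, $\exp$ and $\ln$ of real numbers. There is an absolute constant $C$ such that, for all $N\ge2$, $M\ge1$ and without cost constraint ($P=\Delta_N$): for each $n$ the output $(\hat\lambda,\hat p)$ is computed from $(W,x_0,\gamma)$ by a straight-line program, depending only on $N,M,n$, with at most $C\,MN(n+1)$ operations; and for all $\gamma>0$ and $0<\varepsilon\le1$ there is an $n\le 4\sqrt{D_1D_2}\,\frac1\varepsilon+2\sqrt{D_1/\varepsilon}$ for which such a program has at most $$C\left(\log\tfrac1\gamma\vee\tfrac1{\ln2}\right)\frac{M^2N\sqrt{\log N}}{\varepsilon}$$ operations and its output is an $\varepsilon$-solution for every channel $W$ with $W_{ij}\ge\gamma$ for all $i,j$ and every $x_0\in Q$.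 -/

import Mathlib

namespace DMC

noncomputable section

variable {N M : ℕ}

/-! ### Channels, entropy, mutual information (logarithms to base 2) -/

/-- `W i j` is the probability of output `j` given input `i`. -/
structure IsChannel (W : Matrix (Fin N) (Fin M) ℝ) : Prop where
  nonneg : ∀ i j, 0 ≤ W i j
  row_sum : ∀ i, ∑ j, W i j = 1

/-- Entropy in bits. -/
def entropy {d : ℕ} (p : Fin d → ℝ) : ℝ := ∑ i, -(p i * Real.logb 2 (p i))

/-- The output distribution `Wᵀ p`. -/
def output (W : Matrix (Fin N) (Fin M) ℝ) (p : Fin N → ℝ) (j : Fin M) : ℝ := ∑ i, W i j * p i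

/-- `r i`, the entropy of the output given the input `i`. -/
def condEntropy (W : Matrix (Fin N) (Fin M) ℝ) (i : Fin N) : ℝ :=
  -∑ j, W i j * Real.logb 2 (W i j)

/-- Mutual information `I(p, W) = ∑ᵢ pᵢ D(W(·|i) ‖ pW)`. -/
def mutualInfo (p : Fin N → ℝ) (W : Matrix (Fin N) (Fin M) ℝ) : ℝ :=
  ∑ i, p i * ∑ j, W i j * Real.logb 2 (W i j / output W p j)

/-- Capacity under the average input cost constraint `sᵀ p ≤ S`. -/
def capacity (W : Matrix (Fin N) (Fin M) ℝ) (s : Fin N → ℝ) (S : ℝ) : ℝ :=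
  sSup ((fun p => mutualInfo p W) '' {p | p ∈ stdSimplex ℝ (Fin N) ∧ ∑ i, s i * p i ≤ S})

/-- The least cost of an input distribution that maximizes the mutual information over the
whole simplex. -/
def costThreshold (W : Matrix (Fin N) (Fin M) ℝ) (s : Fin N → ℝ) : ℝ :=
  sInf ((fun p : Fin N → ℝ => ∑ i, s i * p i) ''
    {p | p ∈ stdSimplex ℝ (Fin N) ∧ ∀ p' ∈ stdSimplex ℝ (Fin N), mutualInfo p' W ≤ mutualInfo p W})

/-! ### The primal feasible set and the Lagrange dual -/

/-- Feasible input distributions of the reformulated problem: the whole simplex if there is no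
active cost constraint (`none`), and `{p ∈ Δ_N | sᵀ p = S}` for `some (s, S)`. -/
def feasible : Option ((Fin N → ℝ) × ℝ) → Set (Fin N → ℝ)
  | none => stdSimplex ℝ (Fin N)
  | some (s, S) => {p | p ∈ stdSimplex ℝ (Fin N) ∧ ∑ i, s i * p i = S}

/-- Which reformulation belongs to the capacity problem with constraint `sᵀ p ≤ S`: the equality
constraint if `S` is below the threshold, no constraint otherwise. -/
def Reformulates (W : Matrix (Fin N) (Fin M) ℝ) (c : Option ((Fin N → ℝ) × ℝ))
    (s : Fin N → ℝ) (S : ℝ) : Prop :=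
  (S < costThreshold W s ∧ c = some (s, S)) ∨ (costThreshold W s ≤ S ∧ c = none)

/-- `F(λ) = max {H(q) - λᵀ q | q ∈ Δ_M}`. -/
def F (lam : EuclideanSpace ℝ (Fin M)) : ℝ :=
  sSup ((fun q : Fin M → ℝ => entropy q - ∑ j, lam j * q j) '' stdSimplex ℝ (Fin M))

/-- `-rᵀ p + λᵀ Wᵀ p`. -/
def linObjective (W : Matrix (Fin N) (Fin M) ℝ) (lam : EuclideanSpace ℝ (Fin M))
    (p : Fin N → ℝ) : ℝ :=
  -(∑ i, condEntropy W i * p i) + ∑ j, lam j * output W p j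

/-- `G(λ)`, the maximum of `-rᵀ p + λᵀ Wᵀ p` over the feasible `p`. -/
def G (W : Matrix (Fin N) (Fin M) ℝ) (c : Option ((Fin N → ℝ) × ℝ))
    (lam : EuclideanSpace ℝ (Fin M)) : ℝ :=
  sSup (linObjective W lam '' feasible c)

/-! ### Smoothing -/

/-- `-rᵀ p + λᵀ Wᵀ p + ν H(p) - ν log N`. -/
def smoothObjective (W : Matrix (Fin N) (Fin M) ℝ) (ν : ℝ) (lam : EuclideanSpace ℝ (Fin M))
    (p : Fin N → ℝ) : ℝ :=
  linObjective W lam p + ν * entropy p - ν * Real.logb 2 N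

/-- The smoothed function `G_ν`. -/
def Gsmooth (W : Matrix (Fin N) (Fin M) ℝ) (c : Option ((Fin N → ℝ) × ℝ)) (ν : ℝ)
    (lam : EuclideanSpace ℝ (Fin M)) : ℝ :=
  sSup (smoothObjective W ν lam '' feasible c)

/-- `p_ν(λ)`, the (unique, for `ν > 0`) maximizer in the definition of `G_ν(λ)`. -/
def smoothMaximizer (W : Matrix (Fin N) (Fin M) ℝ) (c : Option ((Fin N → ℝ) × ℝ)) (ν : ℝ)
    (lam : EuclideanSpace ℝ (Fin M)) : Fin N → ℝ :=
  Classical.epsilon fun p => p ∈ feasible c ∧ IsMaxOn (smoothObjective W ν lam) (feasible c) p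

/-! ### The fast gradient scheme -/

/-- Projection onto the closed Euclidean ball of radius `R` about the origin. -/
def proj (R : ℝ) (x : EuclideanSpace ℝ (Fin M)) : EuclideanSpace ℝ (Fin M) :=
  if R < ‖x‖ then (R / ‖x‖) • x else x

section Scheme

variable (g : EuclideanSpace ℝ (Fin M) → EuclideanSpace ℝ (Fin M)) (L R : ℝ)
  (x₀ : EuclideanSpace ℝ (Fin M))

/-- The pair `(x_k, ∑_{i<k} (i+1)/2 • g(x_i))`. -/
def schemeState : ℕ → EuclideanSpace ℝ (Fin M) × EuclideanSpace ℝ (Fin M)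
  | 0 => (x₀, 0)
  | k + 1 =>
    let x := (schemeState k).1
    let a := (schemeState k).2 + (((k : ℝ) + 1) / 2) • g x
    ((2 / ((k : ℝ) + 3)) • proj R (-((1 / L) • a)) +
      (((k : ℝ) + 1) / ((k : ℝ) + 3)) • proj R (-((1 / L) • g x) + x), a)

/-- The query points `x_k`. -/
def schemeX (k : ℕ) : EuclideanSpace ℝ (Fin M) := (schemeState g L R x₀ k).1

/-- The gradient step `y_k`. -/
def schemeY (k : ℕ) : EuclideanSpace ℝ (Fin M) :=
  proj R (-((1 / L) • g (schemeX g L R x₀ k)) + schemeX g L R x₀ k)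

/-- The accumulated gradient step `z_k`. -/
def schemeZ (k : ℕ) : EuclideanSpace ℝ (Fin M) :=
  proj R (-((1 / L) • ∑ i ∈ Finset.range (k + 1), (((i : ℝ) + 1) / 2) • g (schemeX g L R x₀ i)))

theorem schemeState_snd (k : ℕ) : (schemeState g L R x₀ k).2 =
    ∑ i ∈ Finset.range k, (((i : ℝ) + 1) / 2) • g (schemeX g L R x₀ i) := by
  induction k with
  | zero => rfl
  | succ k ih => rw [Finset.sum_range_succ, ← ih]; rfl

theorem schemeX_zero : schemeX g L R x₀ 0 = x₀ := rfl

theorem schemeX_succ (k : ℕ) : schemeX g L R x₀ (k + 1) =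
    (2 / ((k : ℝ) + 3)) • schemeZ g L R x₀ k +
      (((k : ℝ) + 1) / ((k : ℝ) + 3)) • schemeY g L R x₀ k := by
  rw [schemeZ, Finset.sum_range_succ, ← schemeState_snd]; rfl

end Scheme

/-! ### The capacity algorithm -/

/-- The radius of the dual feasible ball `Q`. -/
def radius (M : ℕ) (γ : ℝ) : ℝ := M * max (Real.logb 2 γ⁻¹) (1 / Real.log 2)

/-- The dual feasible ball `Q`. -/
def Q (M : ℕ) (γ : ℝ) : Set (EuclideanSpace ℝ (Fin M)) := {lam | ‖lam‖ ≤ radius M γ}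

def D₁ (M : ℕ) (γ : ℝ) : ℝ := (1 / 2) * (max (M * Real.logb 2 γ⁻¹) (1 / Real.log 2)) ^ 2

def D₂ (N : ℕ) : ℝ := Real.logb 2 N

/-- The smoothing parameter for `n` iterations. -/
def smoothing (N M : ℕ) (γ : ℝ) (n : ℕ) : ℝ := 2 / ((n : ℝ) + 1) * √(D₁ M γ / D₂ N)

/-- `∇F + ∇G_ν`. -/
def smoothGradient (W : Matrix (Fin N) (Fin M) ℝ) (c : Option ((Fin N → ℝ) × ℝ)) (ν : ℝ)
    (x : EuclideanSpace ℝ (Fin M)) : EuclideanSpace ℝ (Fin M) :=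
  gradient F x + gradient (Gsmooth W c ν) x

/-- `x_k` for the run with smoothing parameter `ν(n)` and step constant `L_ν = 1 + 1/ν`. -/
def queryPoint (W : Matrix (Fin N) (Fin M) ℝ) (c : Option ((Fin N → ℝ) × ℝ)) (γ : ℝ)
    (x₀ : EuclideanSpace ℝ (Fin M)) (n k : ℕ) : EuclideanSpace ℝ (Fin M) :=
  schemeX (smoothGradient W c (smoothing N M γ n)) (1 + 1 / smoothing N M γ n) (radius M γ) x₀ k

/-- The approximate dual solution `λ̂ = y_n`. -/
def lamHat (W : Matrix (Fin N) (Fin M) ℝ) (c : Option ((Fin N → ℝ) × ℝ)) (γ : ℝ)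
    (x₀ : EuclideanSpace ℝ (Fin M)) (n : ℕ) : EuclideanSpace ℝ (Fin M) :=
  schemeY (smoothGradient W c (smoothing N M γ n)) (1 + 1 / smoothing N M γ n) (radius M γ) x₀ n

/-- The approximate optimal input distribution `p̂`. -/
def pHat (W : Matrix (Fin N) (Fin M) ℝ) (c : Option ((Fin N → ℝ) × ℝ)) (γ : ℝ)
    (x₀ : EuclideanSpace ℝ (Fin M)) (n : ℕ) : Fin N → ℝ :=
  ∑ k ∈ Finset.range (n + 1), (2 * ((k : ℝ) + 1) / (((n : ℝ) + 1) * ((n : ℝ) + 2))) •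
    smoothMaximizer W c (smoothing N M γ n) (queryPoint W c γ x₀ n k)

/-- `(λ, p)` solves the dual problem, its primal, and the capacity problems that reduce to it,
all up to an additive error `ε`. -/
structure IsEpsSolution (W : Matrix (Fin N) (Fin M) ℝ) (c : Option ((Fin N → ℝ) × ℝ)) (ε : ℝ)
    (lam : EuclideanSpace ℝ (Fin M)) (p : Fin N → ℝ) : Prop where
  mem : p ∈ feasible c
  gap : F lam + G W c lam - mutualInfo p W ≤ ε
  dual : ∀ lam', F lam + G W c lam ≤ F lam' + G W c lam' + ε
  primal : ∀ p' ∈ feasible c, mutualInfo p' W ≤ mutualInfo p W + ε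
  capacity_lower : ∀ s S, Reformulates W c s S →
    mutualInfo p W ≤ capacity W s S ∧ capacity W s S ≤ mutualInfo p W + ε
  capacity_upper : ∀ s S, Reformulates W c s S →
    capacity W s S ≤ F lam + G W c lam ∧ F lam + G W c lam ≤ capacity W s S + ε

/-- The bound on the number of iterations for accuracy `ε`. -/
def iterationBound (N M : ℕ) (γ ε : ℝ) : ℝ :=
  4 * √(D₁ M γ * D₂ N) * (1 / ε) + 2 * √(D₁ M γ / ε)

/-! ### Arithmetic operation counts -/

/-- `StraightLine k S`: there is a straight-line computation on real inputs `v : ι → ℝ` that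
performs `k` operations and whose available values, as functions of the input, are those in `S`.
Each natural constant, `+`, `-`, `*`, `/`, `max`, `√`, `exp` and `ln` costs one operation. -/
inductive StraightLine {ι : Type} : ℕ → Set ((ι → ℝ) → ℝ) → Prop
  | inputs : StraightLine 0 (Set.range fun i v => v i)
  | const {k S} (a : ℕ) : StraightLine k S → StraightLine (k + 1) (insert (fun _ => (a : ℝ)) S)
  | add {k S f h} : StraightLine k S → f ∈ S → h ∈ S →
      StraightLine (k + 1) (insert (fun v => f v + h v) S)
  | sub {k S f h} : StraightLine k S → f ∈ S → h ∈ S →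
      StraightLine (k + 1) (insert (fun v => f v - h v) S)
  | mul {k S f h} : StraightLine k S → f ∈ S → h ∈ S →
      StraightLine (k + 1) (insert (fun v => f v * h v) S)
  | div {k S f h} : StraightLine k S → f ∈ S → h ∈ S →
      StraightLine (k + 1) (insert (fun v => f v / h v) S)
  | max {k S f h} : StraightLine k S → f ∈ S → h ∈ S →
      StraightLine (k + 1) (insert (fun v => Max.max (f v) (h v)) S)
  | sqrt {k S f} : StraightLine k S → f ∈ S → StraightLine (k + 1) (insert (fun v => √(f v)) S)
  | exp {k S f} : StraightLine k S → f ∈ S →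
      StraightLine (k + 1) (insert (fun v => Real.exp (f v)) S)
  | log {k S f} : StraightLine k S → f ∈ S →
      StraightLine (k + 1) (insert (fun v => Real.log (f v)) S)

/-- The input of the algorithm: the entries of `W`, the coordinates of `x₀`, and `γ`. -/
def encode (W : Matrix (Fin N) (Fin M) ℝ) (x₀ : EuclideanSpace ℝ (Fin M)) (γ : ℝ) :
    (Fin N × Fin M) ⊕ Fin M ⊕ Unit → ℝ :=
  Sum.elim (fun ij => W ij.1 ij.2) (Sum.elim (fun j => x₀ j) fun _ => γ)

/-- For `N` inputs, `M` outputs and no cost constraint, one straight-line computation with `k`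
operations yields the results `λ̂` and `p̂` of `n` iterations, for all admissible data. -/
def RunsInOps (N M n k : ℕ) : Prop :=
  ∃ S : Set (((Fin N × Fin M) ⊕ Fin M ⊕ Unit → ℝ) → ℝ), StraightLine k S ∧
    ∃ (lam : Fin M → ((Fin N × Fin M) ⊕ Fin M ⊕ Unit → ℝ) → ℝ)
      (p : Fin N → ((Fin N × Fin M) ⊕ Fin M ⊕ Unit → ℝ) → ℝ),
      (∀ j, lam j ∈ S) ∧ (∀ i, p i ∈ S) ∧
      ∀ (W : Matrix (Fin N) (Fin M) ℝ) (γ : ℝ) (x₀ : EuclideanSpace ℝ (Fin M)),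
        IsChannel W → 0 < γ → (∀ i j, γ ≤ W i j) → x₀ ∈ Q M γ →
        (∀ j, lam j (encode W x₀ γ) = lamHat W none γ x₀ n j) ∧
        (∀ i, p i (encode W x₀ γ) = pHat W none γ x₀ n i)

end

end DMC

/-!
By the inequality of Pinsker the entropy is strongly concave with respect to the `ℓ¹` norm. Hence
`F` and `G_ν`, being conjugates of entropic objectives, are convex, and their gradients, which are
given by the maximizers, are Lipschitz with constants `1` and `1 / ν`.

The fast gradient scheme keeps `(n + 1) (n + 2) / 4` times the value at `y_n` below an estimate
function: the accumulated tangent planes at the query points plus a proximal term. Each tangent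
plane at a point `u` is at most the Lagrangian at `u` and `p_ν(x_k)`, so their weighted average is
at most the Lagrangian at `u` and `p̂`. At the multiplier `u = -log (Wᵀ p̂)` the latter does not
exceed the mutual information of `p̂`, and `u` has norm at most `√M log (1 / γ)`, which is smaller
than the radius by a factor `√M`; the slack pays for a starting point other than the origin.

Without cost constraint all maximizers are Gibbs distributions, so that one iteration costs
`O(MN)` operations.
-/

namespace DMC

/-! ### Pinsker's inequality and strong concavity of the entropy -/

section Pinsker

open InformationTheory Real

theorem hasDerivAt_id_sub_four_add_inv {u : ℝ} (hu : u + 2 ≠ 0) :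
    HasDerivAt (fun u : ℝ => 3 / 2 * (u - 4 + 9 / (u + 2))) (3 / 2 - 27 / 2 / (u + 2) ^ 2) u := by
  have hden : HasDerivAt (fun u : ℝ => u + 2) 1 u := (hasDerivAt_id u).add_const 2
  refine ((((hasDerivAt_id u).sub_const 4).add
    ((hasDerivAt_const u (9 : ℝ)).div hden hu)).const_mul (3 / 2)).congr_deriv ?_
  field_simp
  ring

theorem hasDerivAt_log_sub_add_inv_sq {u : ℝ} (hu : 0 < u) :
    HasDerivAt (fun u : ℝ => log u - (3 / 2 - 27 / 2 / (u + 2) ^ 2))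
      (u⁻¹ - 27 / (u + 2) ^ 3) u := by
  have hden : HasDerivAt (fun u : ℝ => (u + 2) ^ 2) (2 * (u + 2)) u := by
    simpa using ((hasDerivAt_id u).add_const (2 : ℝ)).fun_pow 2
  refine ((hasDerivAt_log hu.ne').sub (((hasDerivAt_const u (27 / 2 : ℝ)).div hden
    (by positivity)).const_sub (3 / 2))).congr_deriv ?_
  field_simp
  ring

theorem sq_sub_one_le_mul_klFun {u : ℝ} (hu : 0 ≤ u) :
    (u - 1) ^ 2 ≤ 2 / 3 * (u + 2) * klFun u := by
  -- `(u - 1) ^ 2 / (u + 2) = u - 4 + 9 / (u + 2)`, and the difference below is convex because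
  -- `27 u ≤ (u + 2) ^ 3`, with a stationary zero at `u = 1`.
  set f : ℝ → ℝ := fun u => klFun u - 3 / 2 * (u - 4 + 9 / (u + 2)) with hf
  have hderiv : ∀ u, 0 < u → HasDerivAt f (log u - (3 / 2 - 27 / 2 / (u + 2) ^ 2)) u := fun u hu =>
    (hasDerivAt_klFun hu.ne').sub (hasDerivAt_id_sub_four_add_inv (by positivity))
  have hcont : ContinuousOn f (Set.Ici 0) := by
    have : ∀ u ∈ Set.Ici (0 : ℝ), u + 2 ≠ 0 := fun u hu => by
      have : 0 ≤ u := hu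
      positivity
    fun_prop (disch := assumption)
  have hconvex : ConvexOn ℝ (Set.Ici 0) f := by
    refine convexOn_of_hasDerivWithinAt2_nonneg (convex_Ici 0) hcont
      (f' := fun u => log u - (3 / 2 - 27 / 2 / (u + 2) ^ 2))
      (f'' := fun u => u⁻¹ - 27 / (u + 2) ^ 3) ?_ ?_ ?_ <;> rw [interior_Ici] <;> intro u hu
    · exact (hderiv u hu).hasDerivWithinAt
    · exact (hasDerivAt_log_sub_add_inv_sq hu).hasDerivWithinAt
    · have hu : 0 < u := hu
      rw [sub_nonneg, ← one_div, div_le_div_iff₀ (by positivity) hu]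
      nlinarith [mul_nonneg (sq_nonneg (u - 1)) (by linarith : 0 ≤ u + 8)]
  have hmin : IsMinOn f (Set.Ici 0) 1 := by
    refine hconvex.isMinOn_of_rightDeriv_eq_zero (by simp) ?_
    rw [((hderiv 1 one_pos).hasDerivWithinAt).derivWithin (uniqueDiffWithinAt_Ioi 1), log_one]
    norm_num
  have hf1 : f 1 = 0 := by simp only [hf, klFun_one]; norm_num
  have hfu : 0 ≤ f u := hf1 ▸ hmin hu
  calc (u - 1) ^ 2 = 2 / 3 * (u + 2) * (3 / 2 * (u - 4 + 9 / (u + 2))) := by field_simp; ring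
    _ ≤ 2 / 3 * (u + 2) * klFun u := by gcongr; exact sub_nonneg.1 hfu

theorem mul_klFun_div {p q : ℝ} (h0 : q = 0 → p = 0) :
    q * klFun (p / q) = p * (log p - log q) + q - p := by
  rcases eq_or_ne q 0 with rfl | hq
  · simp [h0 rfl]
  rcases eq_or_ne p 0 with rfl | hp
  · simp [klFun_zero]
  rw [klFun_apply, log_div hp hq]
  field_simp

theorem sq_sub_le_mul_klFun_div {p q : ℝ} (hp : 0 ≤ p) (hq : 0 ≤ q) (h0 : q = 0 → p = 0) :
    (p - q) ^ 2 ≤ 2 / 3 * (p + 2 * q) * (q * klFun (p / q)) := by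
  rcases hq.eq_or_lt with rfl | hq
  · simp [h0 rfl]
  calc (p - q) ^ 2 = q ^ 2 * (p / q - 1) ^ 2 := by field_simp
    _ ≤ q ^ 2 * (2 / 3 * (p / q + 2) * klFun (p / q)) := by
        gcongr; exact sq_sub_one_le_mul_klFun (by positivity)
    _ = 2 / 3 * (p + 2 * q) * (q * klFun (p / q)) := by field_simp

variable {ι : Type*} [Fintype ι] {p q : ι → ℝ}

/-- The relative entropy (Kullback–Leibler divergence) in nats of weights `p` with respect to
weights `q`. The summand is the usual one only where `q i = 0` implies `p i = 0`. -/
noncomputable def relEntropy (p q : ι → ℝ) : ℝ := ∑ i, p i * (log (p i) - log (q i))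

theorem relEntropy_eq_sum_mul_klFun (hp : p ∈ stdSimplex ℝ ι) (hq : q ∈ stdSimplex ℝ ι)
    (h0 : ∀ i, q i = 0 → p i = 0) : relEntropy p q = ∑ i, q i * klFun (p i / q i) := by
  simp only [mul_klFun_div (h0 _), Finset.sum_sub_distrib, Finset.sum_add_distrib, hp.2, hq.2,
    relEntropy, add_sub_cancel_right]

theorem sq_sum_abs_sub_le_relEntropy (hp : p ∈ stdSimplex ℝ ι) (hq : q ∈ stdSimplex ℝ ι)
    (h0 : ∀ i, q i = 0 → p i = 0) : (∑ i, |p i - q i|) ^ 2 ≤ 2 * relEntropy p q := by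
  have cauchySchwarz := Finset.sum_sq_le_sum_mul_sum_of_sq_le_mul Finset.univ
    (r := fun i => |p i - q i|) (f := fun i => 2 / 3 * (p i + 2 * q i))
    (g := fun i => q i * klFun (p i / q i))
    (fun i _ => by have := hp.1 i; have := hq.1 i; positivity)
    (fun i _ => mul_nonneg (hq.1 i) (klFun_nonneg (div_nonneg (hp.1 i) (hq.1 i))))
    (fun i _ => by rw [sq_abs]; exact sq_sub_le_mul_klFun_div (hp.1 i) (hq.1 i) (h0 i))
  have weights : ∑ i, 2 / 3 * (p i + 2 * q i) = 2 := by
    rw [← Finset.mul_sum, Finset.sum_add_distrib, ← Finset.mul_sum, hp.2, hq.2]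
    norm_num
  rwa [weights, ← relEntropy_eq_sum_mul_klFun hp hq h0] at cauchySchwarz

theorem relEntropy_nonneg (hp : p ∈ stdSimplex ℝ ι) (hq : q ∈ stdSimplex ℝ ι)
    (h0 : ∀ i, q i = 0 → p i = 0) : 0 ≤ relEntropy p q := by
  linarith [sq_sum_abs_sub_le_relEntropy hp hq h0, sq_nonneg (∑ i, |p i - q i|)]

theorem sq_mul_sum_abs_sub_le_relEntropy_mix (hp : p ∈ stdSimplex ℝ ι) (hq : q ∈ stdSimplex ℝ ι)
    {s t : ℝ} (hs : 0 < s) (ht : 0 ≤ t) (hst : s + t = 1) :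
    t ^ 2 * (∑ i, |p i - q i|) ^ 2 ≤ 2 * relEntropy p (s • p + t • q) := by
  have hdist : ∑ i, |p i - (s • p + t • q) i| = t * ∑ i, |p i - q i| := by
    rw [Finset.mul_sum]
    refine Finset.sum_congr rfl fun i _ => ?_
    rw [← abs_of_nonneg ht, ← abs_mul, abs_of_nonneg ht]
    congr 1
    simp only [Pi.add_apply, Pi.smul_apply, smul_eq_mul]
    linear_combination (-p i) * hst
  rw [← mul_pow, ← hdist]
  refine sq_sum_abs_sub_le_relEntropy hp (convex_stdSimplex ℝ ι hp hq hs.le ht hst) fun i hi => ?_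
  have hi : s * p i + t * q i = 0 := by simpa using hi
  have := mul_nonneg ht (hq.1 i)
  nlinarith [hp.1 i]

theorem sum_negMulLog_smul_add_smul (p q : ι → ℝ) (s t : ℝ) :
    ∑ i, negMulLog ((s • p + t • q) i) = s * ∑ i, negMulLog (p i) + t * ∑ i, negMulLog (q i) +
      (s * relEntropy p (s • p + t • q) + t * relEntropy q (s • p + t • q)) := by
  simp only [relEntropy, negMulLog, Pi.add_apply, Pi.smul_apply, smul_eq_mul, Finset.mul_sum,
    ← Finset.sum_add_distrib]
  exact Finset.sum_congr rfl fun i _ => by ring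

theorem strongConcaveOn_sum_negMulLog :
    StrongConcaveOn (WithLp.ofLp ⁻¹' stdSimplex ℝ ι : Set (PiLp 1 fun _ : ι => ℝ)) 1
      fun p => ∑ i, negMulLog (p i) := by
  refine ⟨(convex_stdSimplex ℝ ι).linear_preimage (WithLp.linearEquiv 1 ℝ _).toLinearMap, ?_⟩
  rintro ⟨p⟩ hp ⟨q⟩ hq s t hs ht hst
  rcases hs.eq_or_lt with rfl | hs
  · simp [show t = 1 by linarith]
  rcases ht.eq_or_lt with rfl | ht
  · simp [show s = 1 by linarith]
  have hnorm : ‖(WithLp.toLp 1 p - WithLp.toLp 1 q : PiLp 1 fun _ : ι => ℝ)‖ =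
      ∑ i, |p i - q i| := by simp [PiLp.norm_eq_of_L1]
  have hp' := mul_le_mul_of_nonneg_left
    (sq_mul_sum_abs_sub_le_relEntropy_mix hp hq hs ht.le hst) hs.le
  have hq' := mul_le_mul_of_nonneg_left
    (sq_mul_sum_abs_sub_le_relEntropy_mix hq hp ht hs.le (by linarith)) ht.le
  simp only [abs_sub_comm (q _), add_comm (t • q)] at hq'
  have split : s * t * (1 / 2 * (∑ i, |p i - q i|) ^ 2) =
      s * (t ^ 2 * (∑ i, |p i - q i|) ^ 2) / 2 + t * (s ^ 2 * (∑ i, |p i - q i|) ^ 2) / 2 := by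
    linear_combination (-s * t / 2 * (∑ i, |p i - q i|) ^ 2) * hst
  change s * _ + t * _ + s * t * (1 / 2 * ‖WithLp.toLp 1 p - WithLp.toLp 1 q‖ ^ 2) ≤
    ∑ i, negMulLog ((s • p + t • q) i)
  rw [sum_negMulLog_smul_add_smul, hnorm, split]
  simp only
  linarith

end Pinsker

section Entropy

variable {d : ℕ} {p q : Fin d → ℝ}

theorem entropy_eq_sum_negMulLog_div (p : Fin d → ℝ) :
    entropy p = (∑ i, Real.negMulLog (p i)) / Real.log 2 := by
  simp only [entropy, Finset.sum_div, Real.negMulLog, Real.logb, mul_div_assoc, neg_mul, neg_div]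

@[fun_prop]
theorem continuous_entropy : Continuous (entropy : (Fin d → ℝ) → ℝ) := by
  rw [funext entropy_eq_sum_negMulLog_div]
  fun_prop

theorem entropy_nonneg (hp : p ∈ stdSimplex ℝ (Fin d)) : 0 ≤ entropy p := by
  rw [entropy_eq_sum_negMulLog_div]
  have hterm : ∀ i, 0 ≤ Real.negMulLog (p i) := fun i =>
    Real.negMulLog_nonneg (hp.1 i) (mem_Icc_of_mem_stdSimplex hp i).2
  exact div_nonneg (Finset.sum_nonneg fun i _ => hterm i) (Real.log_pos one_lt_two).le

theorem strongConcaveOn_entropy :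
    StrongConcaveOn (WithLp.ofLp ⁻¹' stdSimplex ℝ (Fin d) : Set (PiLp 1 fun _ : Fin d => ℝ)) 1
      fun p => entropy p.ofLp := by
  refine ⟨strongConcaveOn_sum_negMulLog.1, fun p hp q hq s t hs ht hst => ?_⟩
  have hlog : 0 < Real.log 2 := Real.log_pos one_lt_two
  have hlog' : Real.log 2 ≤ 1 := by linarith [Real.log_two_lt_d9]
  have hnats := strongConcaveOn_sum_negMulLog.2 hp hq hs ht hst
  simp only [smul_eq_mul, entropy_eq_sum_negMulLog_div] at hnats ⊢
  calc _ ≤ s * ((∑ i, Real.negMulLog (p i)) / Real.log 2) +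
        t * ((∑ i, Real.negMulLog (q i)) / Real.log 2) +
        s * t * (1 / 2 * ‖p - q‖ ^ 2) / Real.log 2 := by
        gcongr
        exact le_div_self (by positivity) hlog hlog'
    _ = (s * ∑ i, Real.negMulLog (p i) + t * ∑ i, Real.negMulLog (q i) +
        s * t * (1 / 2 * ‖p - q‖ ^ 2)) / Real.log 2 := by ring
    _ ≤ _ := div_le_div_of_nonneg_right hnats hlog.le

theorem entropy_le_crossEntropy (hp : p ∈ stdSimplex ℝ (Fin d)) (hq : q ∈ stdSimplex ℝ (Fin d))
    (hpos : ∀ i, 0 < q i) : entropy p ≤ -∑ i, p i * Real.logb 2 (q i) := by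
  have hlog : 0 < Real.log 2 := Real.log_pos one_lt_two
  have hdiff : -∑ i, p i * Real.logb 2 (q i) - entropy p = relEntropy p q / Real.log 2 := by
    simp only [entropy, relEntropy, Real.logb, Finset.sum_div, ← Finset.sum_neg_distrib,
      ← Finset.sum_sub_distrib]
    exact Finset.sum_congr rfl fun i _ => by ring
  have := div_nonneg (relEntropy_nonneg hp hq fun i hi => absurd hi (hpos i).ne') hlog.le
  linarith

theorem entropy_le_logb (hp : p ∈ stdSimplex ℝ (Fin d)) : entropy p ≤ Real.logb 2 d := by
  have hd : (0 : ℝ) < d := by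
    rcases Nat.eq_zero_or_pos d with rfl | hd
    · simpa using hp.2
    · exact_mod_cast hd
  have h := entropy_le_crossEntropy (q := fun _ => (d : ℝ)⁻¹) hp
    ⟨fun _ => by positivity, by simp [hd.ne']⟩ fun _ => by positivity
  rwa [← Finset.sum_mul, hp.2, one_mul, Real.logb_inv, neg_neg] at h

end Entropy

/-! ### Smooth convex functions and conjugates of strongly concave functions -/

section Conjugate

open scoped RealInnerProductSpace

variable {X E : Type*} [NormedAddCommGroup X] [NormedSpace ℝ X]
  [NormedAddCommGroup E] [InnerProductSpace ℝ E]

/-- The convex function `f` with gradient field `g` is `L`-smooth. Convexity and smoothness are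
encoded by the affine minorant and the quadratic majorant of `f` at every point. -/
structure IsSmoothConvex (L : ℝ) (f : E → ℝ) (g : E → E) : Prop where
  add_inner_le : ∀ x y, f x + ⟪g x, y - x⟫ ≤ f y
  le_add_inner : ∀ x y, f y ≤ f x + ⟪g x, y - x⟫ + L / 2 * ‖y - x‖ ^ 2

variable {L L' : ℝ} {f f' : E → ℝ} {g g' : E → E}

theorem IsSmoothConvex.add (hf : IsSmoothConvex L f g) (hf' : IsSmoothConvex L' f' g') :
    IsSmoothConvex (L + L') (fun x => f x + f' x) fun x => g x + g' x where
  add_inner_le x y := by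
    rw [inner_add_left]
    linarith [hf.add_inner_le x y, hf'.add_inner_le x y]
  le_add_inner x y := by
    rw [inner_add_left]
    linarith [hf.le_add_inner x y, hf'.le_add_inner x y]

theorem IsSmoothConvex.hasGradientAt [CompleteSpace E] (hf : IsSmoothConvex L f g) (x : E) :
    HasGradientAt f (g x) x := by
  rw [hasGradientAt_iff_isLittleO]
  have quadratic : (fun y => f y - f x - ⟪g x, y - x⟫) =O[nhds x] fun y => ‖y - x‖ ^ 2 := by
    refine Asymptotics.IsBigO.of_bound (L / 2) (Filter.Eventually.of_forall fun y => ?_)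
    rw [Real.norm_of_nonneg (by linarith [hf.add_inner_le x y]),
      Real.norm_of_nonneg (by positivity)]
    linarith [hf.le_add_inner x y]
  exact quadratic.trans_isLittleO (Asymptotics.isLittleO_pow_sub_sub x one_lt_two)

theorem sSup_image_eq_of_isMaxOn {α : Type*} {f : α → ℝ} {K : Set α} {p : α} (hp : p ∈ K)
    (hmax : IsMaxOn f K p) : sSup (f '' K) = f p :=
  IsGreatest.csSup_eq ⟨Set.mem_image_of_mem f hp, Set.forall_mem_image.2 fun _ hq => hmax hq⟩

theorem add_sq_le_of_isMaxOn {K : Set X} {φ : X → ℝ} {ν : ℝ} (hφ : StrongConcaveOn K ν φ)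
    {p q : X} (hp : p ∈ K) (hmax : IsMaxOn φ K p) (hq : q ∈ K) :
    φ q + ν / 2 * ‖q - p‖ ^ 2 ≤ φ p := by
  -- Compare `p` with the point at parameter `t` on the segment to `q` and let `t → 0`.
  have hsegment : ∀ t ∈ Set.Ioo (0 : ℝ) 1,
      φ q + ν / 2 * ‖q - p‖ ^ 2 - φ p ≤ ν / 2 * ‖q - p‖ ^ 2 * t := by
    rintro t ⟨ht0, ht1⟩
    have h1t : 0 ≤ 1 - t := by linarith
    have hconcave : t * φ q + (1 - t) * φ p + t * (1 - t) * (ν / 2 * ‖q - p‖ ^ 2) ≤ φ p :=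
      (hφ.2 hq hp ht0.le h1t (by ring)).trans (hmax (hφ.1 hq hp ht0.le h1t (by ring)))
    refine le_of_mul_le_mul_left ?_ ht0
    linarith
  have hlim : Filter.Tendsto (fun t : ℝ => ν / 2 * ‖q - p‖ ^ 2 * t) (nhdsWithin 0 (Set.Ioi 0))
      (nhds (ν / 2 * ‖q - p‖ ^ 2 * 0)) :=
    ((continuous_const.mul continuous_id).tendsto 0).mono_left nhdsWithin_le_nhds
  linarith [ge_of_tendsto hlim (Filter.mem_of_superset (Ioo_mem_nhdsGT one_pos) hsegment)]

/-- The function `x ↦ sup {φ p + ⟪A p, x⟫ | p ∈ K}`, that is the convex conjugate of `-φ` on `K`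
composed with the adjoint of `A`. -/
noncomputable def conjugate (φ : X → ℝ) (K : Set X) (A : X →L[ℝ] E) (x : E) : ℝ :=
  sSup ((fun p => φ p + ⟪A p, x⟫) '' K)

variable {φ : X → ℝ} {K : Set X} {A : X →L[ℝ] E} {ν : ℝ}

theorem strongConcaveOn_add_inner (hφ : StrongConcaveOn K ν φ) (x : E) :
    StrongConcaveOn K ν fun p => φ p + ⟪A p, x⟫ := by
  have hlin : ConcaveOn ℝ K fun p => ⟪A p, x⟫ :=
    ((innerₗ E).flip x ∘ₗ A.toLinearMap).concaveOn hφ.1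
  have h := UniformConcaveOn.add hφ (uniformConcaveOn_zero.2 hlin)
  rwa [add_zero] at h

/-- Young's inequality absorbs the change of the linear term into the quadratic growth of the
strongly concave objective away from its maximizer. -/
theorem add_inner_le_of_isMaxOn (hφ : StrongConcaveOn K ν φ) (hν : 0 < ν) (hA : ‖A‖ ≤ 1) {x : E}
    {p q : X} (hp : p ∈ K) (hmax : IsMaxOn (fun p => φ p + ⟪A p, x⟫) K p) (hq : q ∈ K) (y : E) :
    φ q + ⟪A q, y⟫ ≤ φ p + ⟪A p, x⟫ + ⟪A p, y - x⟫ + 1 / ν / 2 * ‖y - x‖ ^ 2 := by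
  have growth : φ q + ⟪A q, x⟫ + ν / 2 * ‖q - p‖ ^ 2 ≤ φ p + ⟪A p, x⟫ :=
    add_sq_le_of_isMaxOn (strongConcaveOn_add_inner hφ x) hp hmax hq
  have cauchySchwarz : ⟪A (q - p), y - x⟫ ≤ ‖q - p‖ * ‖y - x‖ :=
    (real_inner_le_norm _ _).trans (by
      gcongr
      exact A.le_of_opNorm_le_of_le hA le_rfl |>.trans_eq (one_mul _))
  have young : ‖q - p‖ * ‖y - x‖ ≤ ν / 2 * ‖q - p‖ ^ 2 + 1 / ν / 2 * ‖y - x‖ ^ 2 := by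
    have : ν / 2 * ‖q - p‖ ^ 2 + 1 / ν / 2 * ‖y - x‖ ^ 2 - ‖q - p‖ * ‖y - x‖ =
        (ν * ‖q - p‖ - ‖y - x‖) ^ 2 / (2 * ν) := by field_simp; ring
    have : 0 ≤ (ν * ‖q - p‖ - ‖y - x‖) ^ 2 / (2 * ν) := by positivity
    linarith
  simp only [map_sub, inner_sub_left, inner_sub_right] at cauchySchwarz ⊢
  linarith

theorem isSmoothConvex_conjugate (hφ : StrongConcaveOn K ν φ) (hν : 0 < ν) (hA : ‖A‖ ≤ 1)
    {P : E → X} (hP : ∀ x, P x ∈ K) (hmax : ∀ x, IsMaxOn (fun p => φ p + ⟪A p, x⟫) K (P x)) :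
    IsSmoothConvex (1 / ν) (conjugate φ K A) fun x => A (P x) := by
  have hconj : ∀ x, conjugate φ K A x = φ (P x) + ⟪A (P x), x⟫ := fun x =>
    sSup_image_eq_of_isMaxOn (hP x) (hmax x)
  refine ⟨fun x y => ?_, fun x y => ?_⟩
  · have : φ (P x) + ⟪A (P x), y⟫ ≤ φ (P y) + ⟪A (P y), y⟫ := hmax y (hP x)
    rw [hconj, hconj, inner_sub_right]
    linarith
  · rw [hconj x, hconj y]
    exact add_inner_le_of_isMaxOn hφ hν hA (hP x) (hmax x) (hP y) y

end Conjugate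

/-! ### Entropic objectives and Gibbs distributions -/

section EntropicObjective

variable {d : ℕ}

/-- The linear function with coefficients `a`, regularized by `ν` times the entropy. -/
noncomputable def entropicObjective (a : Fin d → ℝ) (ν : ℝ) (p : Fin d → ℝ) : ℝ :=
  ∑ i, a i * p i + ν * entropy p

@[fun_prop]
theorem continuous_entropicObjective (a : Fin d → ℝ) (ν : ℝ) :
    Continuous (entropicObjective a ν) := by
  unfold entropicObjective
  fun_prop

theorem sum_mul_smul_add_smul (a p q : Fin d → ℝ) (s t : ℝ) :
    ∑ i, a i * (s • p + t • q) i = s * ∑ i, a i * p i + t * ∑ i, a i * q i := by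
  simp only [Finset.mul_sum, ← Finset.sum_add_distrib, Pi.add_apply, Pi.smul_apply, smul_eq_mul]
  exact Finset.sum_congr rfl fun i _ => by ring

theorem strongConcaveOn_entropicObjective {K : Set (Fin d → ℝ)} (hK : Convex ℝ K)
    (hsub : K ⊆ stdSimplex ℝ (Fin d)) (a : Fin d → ℝ) {ν : ℝ} (hν : 0 ≤ ν) :
    StrongConcaveOn (WithLp.ofLp ⁻¹' K : Set (PiLp 1 fun _ : Fin d => ℝ)) ν
      fun p => entropicObjective a ν p.ofLp := by
  refine ⟨hK.linear_preimage (WithLp.linearEquiv 1 ℝ _).toLinearMap,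
    fun p hp q hq s t hs ht hst => ?_⟩
  have hentropy := mul_le_mul_of_nonneg_left
    (strongConcaveOn_entropy.2 (hsub hp) (hsub hq) hs ht hst) hν
  have hlin : ∑ i, a i * (s • p + t • q) i = s * ∑ i, a i * p i + t * ∑ i, a i * q i :=
    sum_mul_smul_add_smul a p.ofLp q.ofLp s t
  simp only [entropicObjective, smul_eq_mul] at hentropy ⊢
  rw [hlin]
  linarith

theorem eq_of_isMaxOn_entropicObjective {K : Set (Fin d → ℝ)} (hK : Convex ℝ K)
    (hsub : K ⊆ stdSimplex ℝ (Fin d)) {a : Fin d → ℝ} {ν : ℝ} (hν : 0 < ν) {p q : Fin d → ℝ}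
    (hp : p ∈ K) (hpmax : IsMaxOn (entropicObjective a ν) K p)
    (hq : q ∈ K) (hqmax : IsMaxOn (entropicObjective a ν) K q) : p = q :=
  WithLp.toLp_injective 1 <|
    ((strongConcaveOn_entropicObjective hK hsub a hν.le).strictConcaveOn hν).eq_of_isMaxOn
      (x := WithLp.toLp 1 p) (y := WithLp.toLp 1 q) (fun _ h => hpmax h) (fun _ h => hqmax h) hp hq

/-- The Gibbs distribution with weights `exp (t i)`. -/
noncomputable def gibbs (t : Fin d → ℝ) (i : Fin d) : ℝ := Real.exp (t i) / ∑ k, Real.exp (t k)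

theorem sum_exp_pos (hd : 0 < d) (t : Fin d → ℝ) : 0 < ∑ k, Real.exp (t k) :=
  Finset.sum_pos (fun _ _ => Real.exp_pos _) ⟨⟨0, hd⟩, Finset.mem_univ _⟩

theorem gibbs_pos (t : Fin d → ℝ) (i : Fin d) : 0 < gibbs t i :=
  div_pos (Real.exp_pos _) (sum_exp_pos i.pos t)

theorem gibbs_mem_stdSimplex (hd : 0 < d) (t : Fin d → ℝ) : gibbs t ∈ stdSimplex ℝ (Fin d) :=
  ⟨fun i => (gibbs_pos t i).le, by
    simp only [gibbs, ← Finset.sum_div]; exact div_self (sum_exp_pos hd t).ne'⟩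

theorem logb_gibbs (t : Fin d → ℝ) (i : Fin d) :
    Real.logb 2 (gibbs t i) = t i / Real.log 2 - Real.logb 2 (∑ k, Real.exp (t k)) := by
  rw [gibbs, Real.logb_div (Real.exp_ne_zero _) (sum_exp_pos i.pos t).ne', Real.logb,
    Real.log_exp]

theorem entropicObjective_eq_gibbs (a : Fin d → ℝ) {ν : ℝ} (hν : ν ≠ 0) {p : Fin d → ℝ}
    (hp : p ∈ stdSimplex ℝ (Fin d)) : entropicObjective a ν p =
      ν * (entropy p + ∑ i, p i * Real.logb 2 (gibbs (fun i => a i * Real.log 2 / ν) i)) +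
        ν * Real.logb 2 (∑ k, Real.exp (a k * Real.log 2 / ν)) := by
  have hlog : Real.log 2 ≠ 0 := (Real.log_pos one_lt_two).ne'
  have hlin : ∑ i, p i * (a i * Real.log 2 / ν / Real.log 2) = (∑ i, a i * p i) / ν := by
    rw [Finset.sum_div]
    exact Finset.sum_congr rfl fun i _ => by field_simp
  simp only [logb_gibbs, mul_sub, Finset.sum_sub_distrib, ← Finset.sum_mul, hp.2, hlin,
    one_mul, mul_add, mul_div_cancel₀ _ hν, entropicObjective]
  ring

theorem isMaxOn_gibbs (hd : 0 < d) (a : Fin d → ℝ) {ν : ℝ} (hν : 0 < ν) :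
    IsMaxOn (entropicObjective a ν) (stdSimplex ℝ (Fin d))
      (gibbs fun i => a i * Real.log 2 / ν) := by
  intro p hp
  have hq := gibbs_mem_stdSimplex hd fun i => a i * Real.log 2 / ν
  change entropicObjective a ν p ≤ entropicObjective a ν _
  rw [entropicObjective_eq_gibbs a hν.ne' hp, entropicObjective_eq_gibbs a hν.ne' hq]
  have hself : entropy (gibbs fun i => a i * Real.log 2 / ν) + ∑ i,
      gibbs (fun i => a i * Real.log 2 / ν) i *
        Real.logb 2 (gibbs (fun i => a i * Real.log 2 / ν) i) = 0 := by simp [entropy]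
  rw [hself]
  gcongr
  linarith [entropy_le_crossEntropy hp hq (gibbs_pos _)]

end EntropicObjective

/-! ### The fast gradient scheme -/

section FastGradient

open scoped RealInnerProductSpace

variable {M : ℕ} {R : ℝ}

theorem norm_proj_le (hR : 0 ≤ R) (x : EuclideanSpace ℝ (Fin M)) : ‖proj R x‖ ≤ R := by
  unfold proj
  split_ifs with h
  · have : 0 < ‖x‖ := hR.trans_lt h
    rw [norm_smul, Real.norm_of_nonneg (by positivity), div_mul_cancel₀ _ this.ne']
  · exact not_lt.1 h

theorem inner_sub_proj_nonpos (hR : 0 ≤ R) (w : EuclideanSpace ℝ (Fin M))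
    {u : EuclideanSpace ℝ (Fin M)} (hu : ‖u‖ ≤ R) : ⟪w - proj R w, u - proj R w⟫ ≤ 0 := by
  unfold proj
  split_ifs with h
  · have hw : 0 < ‖w‖ := hR.trans_lt h
    have cauchySchwarz : ⟪w, u⟫ ≤ ‖w‖ * R :=
      (real_inner_le_norm w u).trans (mul_le_mul_of_nonneg_left hu hw.le)
    have hscale : R / ‖w‖ ≤ 1 := (div_le_one hw).2 h.le
    rw [show w - (R / ‖w‖) • w = (1 - R / ‖w‖) • w by rw [sub_smul, one_smul],
      real_inner_smul_left, inner_sub_right, real_inner_smul_right, real_inner_self_eq_norm_sq,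
      show R / ‖w‖ * ‖w‖ ^ 2 = ‖w‖ * R by field_simp]
    exact mul_nonpos_of_nonneg_of_nonpos (by linarith) (by linarith)
  · simp

/-- The projected gradient step `z` minimizes the quadratic model over the ball, and the model
grows quadratically away from `z`. -/
theorem quadraticModel_proj_add_le {L : ℝ} (hR : 0 ≤ R) (hL : 0 < L)
    (g x : EuclideanSpace ℝ (Fin M)) {u : EuclideanSpace ℝ (Fin M)} (hu : ‖u‖ ≤ R) :
    ⟪g, proj R (-((1 / L) • g) + x) - x⟫ + L / 2 * ‖proj R (-((1 / L) • g) + x) - x‖ ^ 2 +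
        L / 2 * ‖u - proj R (-((1 / L) • g) + x)‖ ^ 2 ≤
      ⟪g, u - x⟫ + L / 2 * ‖u - x‖ ^ 2 := by
  have hproj := inner_sub_proj_nonpos hR (-((1 / L) • g) + x) hu
  set z := proj R (-((1 / L) • g) + x)
  rw [show -((1 / L) • g) + x - z = -((1 / L) • g) - (z - x) by abel, inner_sub_left,
    inner_neg_left, real_inner_smul_left] at hproj
  rw [show u - x = (u - z) + (z - x) by abel, inner_add_right, norm_add_sq_real,
    real_inner_comm (z - x) (u - z)]
  have hscaled := mul_nonneg hL.le (sub_nonneg.2 hproj)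
  have : L * (0 - (-(1 / L * ⟪g, u - z⟫) - ⟪z - x, u - z⟫)) =
      ⟪g, u - z⟫ + L * ⟪z - x, u - z⟫ := by field_simp; ring
  linarith

/-- The total weight of the first `k + 1` query points of the scheme. -/
noncomputable def totalWeight (k : ℕ) : ℝ := ((k : ℝ) + 1) * (k + 2) / 4

theorem totalWeight_pos (k : ℕ) : 0 < totalWeight k := by
  unfold totalWeight
  positivity

theorem sum_weights (n : ℕ) :
    ∑ k ∈ Finset.range (n + 1), ((k : ℝ) + 1) / 2 = totalWeight n := by
  induction n with
  | zero => norm_num [totalWeight]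
  | succ n ih => rw [Finset.sum_range_succ, ih, totalWeight, totalWeight]; push_cast; ring

variable {f : EuclideanSpace ℝ (Fin M) → ℝ}
  {g : EuclideanSpace ℝ (Fin M) → EuclideanSpace ℝ (Fin M)} {L : ℝ}
  {x₀ : EuclideanSpace ℝ (Fin M)}

/-- The estimate function of the scheme at step `k`: the accumulated linear models of `f` at the
query points plus the proximal term `L / 2 * ‖u‖ ^ 2`. -/
noncomputable def estimate (f : EuclideanSpace ℝ (Fin M) → ℝ)
    (g : EuclideanSpace ℝ (Fin M) → EuclideanSpace ℝ (Fin M)) (L R : ℝ)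
    (x₀ : EuclideanSpace ℝ (Fin M)) (k : ℕ) (u : EuclideanSpace ℝ (Fin M)) : ℝ :=
  L / 2 * ‖u‖ ^ 2 + ∑ i ∈ Finset.range (k + 1), ((i : ℝ) + 1) / 2 *
    (f (schemeX g L R x₀ i) + ⟪g (schemeX g L R x₀ i), u - schemeX g L R x₀ i⟫)

theorem estimate_schemeZ_add_le (hR : 0 ≤ R) (hL : 0 < L) (k : ℕ)
    {u : EuclideanSpace ℝ (Fin M)} (hu : ‖u‖ ≤ R) :
    estimate f g L R x₀ k (schemeZ g L R x₀ k) + L / 2 * ‖u - schemeZ g L R x₀ k‖ ^ 2 ≤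
      estimate f g L R x₀ k u := by
  set a := ∑ i ∈ Finset.range (k + 1), (((i : ℝ) + 1) / 2) • g (schemeX g L R x₀ i) with ha
  have hquadratic : ∀ v, estimate f g L R x₀ k v = ⟪a, v⟫ + L / 2 * ‖v‖ ^ 2 +
      ∑ i ∈ Finset.range (k + 1), ((i : ℝ) + 1) / 2 *
        (f (schemeX g L R x₀ i) - ⟪g (schemeX g L R x₀ i), schemeX g L R x₀ i⟫) := by
    intro v
    rw [estimate, ha, sum_inner, add_comm, add_right_comm, ← Finset.sum_add_distrib]
    congr 1
    refine Finset.sum_congr rfl fun i _ => ?_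
    rw [real_inner_smul_left, inner_sub_right]
    ring
  have hstep := quadraticModel_proj_add_le hR hL a 0 hu
  simp only [add_zero, sub_zero] at hstep
  rw [hquadratic, hquadratic, show schemeZ g L R x₀ k = proj R (-((1 / L) • a)) from rfl]
  linarith

theorem estimate_succ (k : ℕ) (u : EuclideanSpace ℝ (Fin M)) :
    estimate f g L R x₀ (k + 1) u = estimate f g L R x₀ k u + ((k : ℝ) + 2) / 2 *
      (f (schemeX g L R x₀ (k + 1)) +
        ⟪g (schemeX g L R x₀ (k + 1)), u - schemeX g L R x₀ (k + 1)⟫) := by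
  rw [estimate, Finset.sum_range_succ, ← add_assoc, estimate]
  push_cast
  ring

theorem apply_schemeY_le (hR : 0 ≤ R) (hL : 0 < L) (hf : IsSmoothConvex L f g) (k : ℕ)
    {u : EuclideanSpace ℝ (Fin M)} (hu : ‖u‖ ≤ R) :
    f (schemeY g L R x₀ k) ≤ f (schemeX g L R x₀ k) +
      ⟪g (schemeX g L R x₀ k), u - schemeX g L R x₀ k⟫ +
        L / 2 * ‖u - schemeX g L R x₀ k‖ ^ 2 := by
  have hmodel := hf.le_add_inner (schemeX g L R x₀ k) (schemeY g L R x₀ k)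
  have hstep := quadraticModel_proj_add_le hR hL (g (schemeX g L R x₀ k)) (schemeX g L R x₀ k) hu
  have : 0 ≤ L / 2 * ‖u - schemeY g L R x₀ k‖ ^ 2 := by positivity
  rw [schemeY] at *
  linarith

theorem apply_schemeY_succ_le (hR : 0 ≤ R) (hL : 0 < L) (hf : IsSmoothConvex L f g) (k : ℕ)
    {u : EuclideanSpace ℝ (Fin M)} (hu : ‖u‖ ≤ R) :
    f (schemeY g L R x₀ (k + 1)) ≤ f (schemeX g L R x₀ (k + 1)) +
      (2 / ((k : ℝ) + 3) * ⟪g (schemeX g L R x₀ (k + 1)), u - schemeX g L R x₀ (k + 1)⟫ +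
        ((k : ℝ) + 1) / ((k : ℝ) + 3) *
          ⟪g (schemeX g L R x₀ (k + 1)), schemeY g L R x₀ k - schemeX g L R x₀ (k + 1)⟫) +
      L / 2 * ((2 / ((k : ℝ) + 3)) ^ 2 * ‖u - schemeZ g L R x₀ k‖ ^ 2) := by
  -- Compare with the point `w` obtained from `x (k + 1)` on replacing `z k` by `u`.
  set x := schemeX g L R x₀ (k + 1) with hx
  set y := schemeY g L R x₀ k
  set z := schemeZ g L R x₀ k
  set s : ℝ := 2 / ((k : ℝ) + 3) with hs
  set t : ℝ := ((k : ℝ) + 1) / ((k : ℝ) + 3) with ht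
  have hst : s + t = 1 := by rw [hs, ht]; field_simp; ring
  have hxst : x = s • z + t • y := schemeX_succ g L R x₀ k
  have hw : ‖s • u + t • y‖ ≤ R := mem_closedBall_zero_iff.1 <|
    convex_closedBall (0 : EuclideanSpace ℝ (Fin M)) R (mem_closedBall_zero_iff.2 hu)
      (mem_closedBall_zero_iff.2 (norm_proj_le hR _)) (by positivity) (by positivity) hst
  have hinner : s • u + t • y - x = s • (u - x) + t • (y - x) := by
    rw [smul_sub, smul_sub, sub_add_sub_comm, ← add_smul, hst, one_smul]
  have hnorm : s • u + t • y - x = s • (u - z) := by rw [hxst, smul_sub]; abel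
  have hstep := apply_schemeY_le (x₀ := x₀) hR hL hf (k + 1) hw
  rw [← hx] at hstep
  calc _ ≤ f x + ⟪g x, s • u + t • y - x⟫ + L / 2 * ‖s • u + t • y - x‖ ^ 2 := hstep
    _ = f x + ⟪g x, s • (u - x) + t • (y - x)⟫ + L / 2 * ‖s • (u - z)‖ ^ 2 := by
        rw [← hinner, ← hnorm]
    _ = _ := by
        rw [inner_add_right, real_inner_smul_right, real_inner_smul_right, norm_smul, mul_pow,
          Real.norm_eq_abs, sq_abs]

theorem totalWeight_succ_mul_schemeY_le (hR : 0 ≤ R) (hL : 0 < L) (hf : IsSmoothConvex L f g)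
    (k : ℕ) {u : EuclideanSpace ℝ (Fin M)} (hu : ‖u‖ ≤ R) :
    totalWeight (k + 1) * f (schemeY g L R x₀ (k + 1)) ≤
      totalWeight k * f (schemeY g L R x₀ k) + ((k : ℝ) + 2) / 2 *
        (f (schemeX g L R x₀ (k + 1)) +
          ⟪g (schemeX g L R x₀ (k + 1)), u - schemeX g L R x₀ (k + 1)⟫) +
      L / 2 * ‖u - schemeZ g L R x₀ k‖ ^ 2 := by
  have hstep := mul_le_mul_of_nonneg_left (apply_schemeY_succ_le (x₀ := x₀) hR hL hf k hu)
    (totalWeight_pos (k + 1)).le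
  have hconvex := mul_le_mul_of_nonneg_left
    (hf.add_inner_le (schemeX g L R x₀ (k + 1)) (schemeY g L R x₀ k)) (totalWeight_pos k).le
  have hprox : ((k : ℝ) + 2) / (k + 3) * (L / 2 * ‖u - schemeZ g L R x₀ k‖ ^ 2) ≤
      L / 2 * ‖u - schemeZ g L R x₀ k‖ ^ 2 :=
    mul_le_of_le_one_left (by positivity) ((div_le_one (by positivity)).2 (by linarith))
  refine hstep.trans ?_
  have hsplit : ∀ F A B D : ℝ, totalWeight (k + 1) * (F + (2 / ((k : ℝ) + 3) * A +
      ((k : ℝ) + 1) / ((k : ℝ) + 3) * B) + L / 2 * ((2 / ((k : ℝ) + 3)) ^ 2 * D)) =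
      totalWeight k * (F + B) + ((k : ℝ) + 2) / 2 * (F + A) +
        ((k : ℝ) + 2) / (k + 3) * (L / 2 * D) := by
    intro F A B D
    unfold totalWeight
    push_cast
    field_simp
    ring
  rw [hsplit]
  linarith

theorem apply_schemeY_zero_le_estimate (hR : 0 ≤ R) (hL : 0 < L) (hf : IsSmoothConvex L f g)
    (hx₀ : ‖x₀‖ ≤ R) :
    totalWeight 0 * f (schemeY g L R x₀ 0) ≤ estimate f g L R x₀ 0 (schemeZ g L R x₀ 0) +
      (‖g x₀‖ * R / 2 + ‖g x₀‖ ^ 2 / (8 * L)) := by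
  have hstep := apply_schemeY_le (x₀ := x₀) hR hL hf 0 hx₀
  simp only [schemeX_zero, sub_self, inner_zero_right, norm_zero] at hstep
  set z := schemeZ g L R x₀ 0
  have hinner : -⟪g x₀, z - x₀⟫ ≤ ‖g x₀‖ * R + ‖g x₀‖ * ‖z‖ := by
    rw [← inner_neg_right, neg_sub, ← mul_add]
    refine (real_inner_le_norm _ _).trans ?_
    gcongr
    exact (norm_sub_le _ _).trans (by linarith)
  have hsquare : ‖g x₀‖ * ‖z‖ / 2 - L / 2 * ‖z‖ ^ 2 ≤ ‖g x₀‖ ^ 2 / (8 * L) := by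
    have : ‖g x₀‖ ^ 2 / (8 * L) - (‖g x₀‖ * ‖z‖ / 2 - L / 2 * ‖z‖ ^ 2) =
        (‖g x₀‖ - 2 * L * ‖z‖) ^ 2 / (8 * L) := by field_simp; ring
    have : 0 ≤ (‖g x₀‖ - 2 * L * ‖z‖) ^ 2 / (8 * L) := by positivity
    linarith
  simp only [estimate, totalWeight, zero_add, Finset.sum_range_one, schemeX_zero, Nat.cast_zero]
  linarith

/-- The last two terms are the loss caused by not starting at the centre of the ball. -/
theorem totalWeight_mul_schemeY_le_estimate (hR : 0 ≤ R) (hL : 0 < L)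
    (hf : IsSmoothConvex L f g) (hx₀ : ‖x₀‖ ≤ R) (k : ℕ)
    {u : EuclideanSpace ℝ (Fin M)} (hu : ‖u‖ ≤ R) :
    totalWeight k * f (schemeY g L R x₀ k) ≤ estimate f g L R x₀ k u +
      (‖g x₀‖ * R / 2 + ‖g x₀‖ ^ 2 / (8 * L)) := by
  suffices totalWeight k * f (schemeY g L R x₀ k) ≤ estimate f g L R x₀ k (schemeZ g L R x₀ k) +
      (‖g x₀‖ * R / 2 + ‖g x₀‖ ^ 2 / (8 * L)) by
    have hmin := estimate_schemeZ_add_le (f := f) (g := g) (x₀ := x₀) hR hL k hu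
    have : 0 ≤ L / 2 * ‖u - schemeZ g L R x₀ k‖ ^ 2 := by positivity
    linarith
  induction k with
  | zero => exact apply_schemeY_zero_le_estimate hR hL hf hx₀
  | succ k ih =>
    have hz : ‖schemeZ g L R x₀ (k + 1)‖ ≤ R := norm_proj_le hR _
    have hmin := estimate_schemeZ_add_le (f := f) (g := g) (x₀ := x₀) hR hL k hz
    rw [estimate_succ]
    linarith [totalWeight_succ_mul_schemeY_le (x₀ := x₀) hR hL hf k hz]

end FastGradient

/-! ### The dual function and its smoothing -/

section Output

open scoped RealInnerProductSpace

variable {N M d : ℕ}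

/-- The map `p ↦ Vᵀ p` of matrices `V`, continuous from the `ℓ¹` to the Euclidean norm. -/
noncomputable def outputL (V : Matrix (Fin d) (Fin M) ℝ) :
    PiLp 1 (fun _ : Fin d => ℝ) →L[ℝ] EuclideanSpace ℝ (Fin M) :=
  LinearMap.toContinuousLinearMap
    { toFun := fun p => WithLp.toLp 2 (output V p.ofLp)
      map_add' := fun p q => by
        ext j
        simp [output, mul_add, Finset.sum_add_distrib]
      map_smul' := fun t p => by
        ext j
        simp [output, Finset.mul_sum, mul_left_comm] }

theorem inner_toLp_output (V : Matrix (Fin d) (Fin M) ℝ) (p : Fin d → ℝ)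
    (x : EuclideanSpace ℝ (Fin M)) :
    ⟪WithLp.toLp 2 (output V p), x⟫ = ∑ j, x j * output V p j := by
  simp [PiLp.inner_apply]

theorem sum_mul_output (V : Matrix (Fin d) (Fin M) ℝ) (p : Fin d → ℝ) (x : Fin M → ℝ) :
    ∑ j, x j * output V p j = ∑ i, (∑ j, V i j * x j) * p i := by
  simp only [output, Finset.mul_sum, Finset.sum_mul]
  rw [Finset.sum_comm]
  exact Finset.sum_congr rfl fun i _ => Finset.sum_congr rfl fun j _ => by ring

@[fun_prop]
theorem continuous_output (V : Matrix (Fin d) (Fin M) ℝ) : Continuous (output V) := by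
  unfold output
  fun_prop

theorem output_neg_one (q : Fin M → ℝ) : output (-1) q = -q := by
  funext j
  simp [output, Matrix.neg_apply, Matrix.one_apply]

theorem norm_toLp_two_le_sum_abs (v : Fin M → ℝ) : ‖WithLp.toLp 2 v‖ ≤ ∑ j, |v j| := by
  rw [EuclideanSpace.norm_eq, Real.sqrt_le_left (Finset.sum_nonneg fun j _ => abs_nonneg _)]
  exact Finset.sum_sq_le_sq_sum_of_nonneg fun j _ => abs_nonneg (v j)

theorem norm_outputL_le {V : Matrix (Fin d) (Fin M) ℝ} (hV : ∀ i, ∑ j, |V i j| ≤ 1) :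
    ‖outputL V‖ ≤ 1 := by
  refine ContinuousLinearMap.opNorm_le_bound _ zero_le_one fun p => ?_
  have hrows : outputL V p = ∑ i, p i • WithLp.toLp 2 (V i) := by
    ext j
    simp [outputL, output, mul_comm]
  rw [hrows, one_mul, PiLp.norm_eq_of_L1]
  refine norm_sum_le_of_le _ fun i _ => ?_
  rw [norm_smul]
  exact mul_le_of_le_one_right (norm_nonneg _) ((norm_toLp_two_le_sum_abs (V i)).trans (hV i))

theorem entropicObjective_add_eq_add_inner (V : Matrix (Fin d) (Fin M) ℝ) (a : Fin d → ℝ)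
    (ν : ℝ) (x : EuclideanSpace ℝ (Fin M)) (p : PiLp 1 fun _ : Fin d => ℝ) :
    entropicObjective (fun i => ∑ j, V i j * x j + a i) ν p.ofLp =
      entropicObjective a ν p.ofLp + ⟪outputL V p, x⟫ := by
  change _ = _ + ⟪WithLp.toLp 2 (output V p.ofLp), x⟫
  rw [inner_toLp_output, sum_mul_output]
  simp only [entropicObjective, add_mul, Finset.sum_add_distrib]
  ring

theorem isSmoothConvex_sSup_entropicObjective {K : Set (Fin d → ℝ)} (hK : Convex ℝ K)
    (hsub : K ⊆ stdSimplex ℝ (Fin d)) {V : Matrix (Fin d) (Fin M) ℝ}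
    (hV : ∀ i, ∑ j, |V i j| ≤ 1) {ν : ℝ} (hν : 0 < ν) (a : Fin d → ℝ) (b : ℝ)
    {P : EuclideanSpace ℝ (Fin M) → Fin d → ℝ} (hP : ∀ x, P x ∈ K)
    (hmax : ∀ x, IsMaxOn (fun p => entropicObjective (fun i => ∑ j, V i j * x j + a i) ν p + b) K
      (P x)) :
    IsSmoothConvex (1 / ν)
      (fun x => sSup ((fun p => entropicObjective (fun i => ∑ j, V i j * x j + a i) ν p + b) '' K))
      fun x => WithLp.toLp 2 (output V (P x)) := by
  have hconcave := UniformConcaveOn.add (strongConcaveOn_entropicObjective hK hsub a hν.le)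
    (uniformConcaveOn_zero.2 (concaveOn_const b
      (strongConcaveOn_entropicObjective hK hsub a hν.le).1))
  rw [add_zero] at hconcave
  have hobjective : ∀ (x : EuclideanSpace ℝ (Fin M)) (p : PiLp 1 fun _ : Fin d => ℝ),
      entropicObjective (fun i => ∑ j, V i j * x j + a i) ν p.ofLp + b =
        entropicObjective a ν p.ofLp + b + ⟪outputL V p, x⟫ := by
    intro x p
    rw [entropicObjective_add_eq_add_inner, add_right_comm]
  have hsSup : (fun x => sSup ((fun p =>
      entropicObjective (fun i => ∑ j, V i j * x j + a i) ν p + b) '' K)) =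
      conjugate (fun p => entropicObjective a ν p.ofLp + b) (WithLp.ofLp ⁻¹' K) (outputL V) := by
    funext x
    simp only [conjugate, ← hobjective]
    conv_lhs => rw [← Set.image_preimage_eq K (WithLp.ofLp_surjective 1), Set.image_image]
  rw [hsSup]
  refine isSmoothConvex_conjugate hconcave hν (norm_outputL_le hV)
    (P := fun x => WithLp.toLp 1 (P x)) hP fun x p hp => ?_
  change entropicObjective a ν p.ofLp + b + ⟪outputL V p, x⟫ ≤
    entropicObjective a ν (P x) + b + ⟪outputL V (WithLp.toLp 1 (P x)), x⟫
  rw [← hobjective, ← hobjective]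
  exact hmax x hp

end Output

section Dual

open scoped RealInnerProductSpace

variable {N M : ℕ} {W : Matrix (Fin N) (Fin M) ℝ} {c : Option ((Fin N → ℝ) × ℝ)} {ν : ℝ}

theorem feasible_subset (c : Option ((Fin N → ℝ) × ℝ)) : feasible c ⊆ stdSimplex ℝ (Fin N) := by
  rcases c with _ | ⟨s, S⟩
  · exact subset_rfl
  · exact fun p hp => hp.1

theorem isCompact_feasible (c : Option ((Fin N → ℝ) × ℝ)) : IsCompact (feasible c) := by
  rcases c with _ | ⟨s, S⟩
  · exact isCompact_stdSimplex ℝ (Fin N)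
  · exact (isCompact_stdSimplex ℝ (Fin N)).inter_right
      (isClosed_eq (by fun_prop) continuous_const)

theorem convex_feasible (c : Option ((Fin N → ℝ) × ℝ)) : Convex ℝ (feasible c) := by
  rcases c with _ | ⟨s, S⟩
  · exact convex_stdSimplex ℝ (Fin N)
  · rintro p ⟨hp, hpS⟩ q ⟨hq, hqS⟩ a b ha hb hab
    refine ⟨convex_stdSimplex ℝ _ hp hq ha hb hab, ?_⟩
    rw [sum_mul_smul_add_smul, hpS, hqS, ← add_mul, hab, one_mul]

theorem IsChannel.sum_abs_le (hW : IsChannel W) (i : Fin N) : ∑ j, |W i j| ≤ 1 := by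
  simp only [abs_of_nonneg (hW.nonneg i _), hW.row_sum i, le_refl]

theorem IsChannel.output_mem (hW : IsChannel W) {p : Fin N → ℝ} (hp : p ∈ stdSimplex ℝ (Fin N)) :
    output W p ∈ stdSimplex ℝ (Fin M) := by
  refine ⟨fun j => Finset.sum_nonneg fun i _ => mul_nonneg (hW.nonneg i j) (hp.1 i), ?_⟩
  simpa [hW.row_sum, hp.2] using sum_mul_output W p 1

/-- The maximizer in the definition of `F`. -/
noncomputable def outputMaximizer (lam : EuclideanSpace ℝ (Fin M)) : Fin M → ℝ :=
  gibbs fun j => -lam j * Real.log 2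

theorem entropy_sub_eq_entropicObjective (lam q : Fin M → ℝ) :
    entropy q - ∑ j, lam j * q j = entropicObjective (-lam) 1 q := by
  simp only [entropicObjective, Pi.neg_apply, neg_mul, Finset.sum_neg_distrib]
  ring

theorem isSmoothConvex_F (hM : 0 < M) :
    IsSmoothConvex 1 F fun lam : EuclideanSpace ℝ (Fin M) =>
      WithLp.toLp 2 (-outputMaximizer lam) := by
  have hcoeff : ∀ lam : Fin M → ℝ,
      (fun i => ∑ j, (-1 : Matrix (Fin M) (Fin M) ℝ) i j * lam j + (0 : Fin M → ℝ) i) = -lam := by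
    intro lam
    funext i
    simp [Matrix.neg_apply, Matrix.one_apply]
  have h := isSmoothConvex_sSup_entropicObjective (M := M) (convex_stdSimplex ℝ _) subset_rfl
    (V := -1) (fun i => by simp [Matrix.neg_apply, Matrix.one_apply, apply_ite abs])
    one_pos 0 0 (P := outputMaximizer) (fun _ => gibbs_mem_stdSimplex hM _) fun lam => by
      simpa only [hcoeff, add_zero, div_one, outputMaximizer, Pi.neg_apply]
        using isMaxOn_gibbs hM (-lam.ofLp) one_pos
  simp only [hcoeff, add_zero, div_one, output_neg_one, ← entropy_sub_eq_entropicObjective] at h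
  exact h

theorem smoothObjective_eq_entropicObjective (W : Matrix (Fin N) (Fin M) ℝ) (ν : ℝ)
    (lam : EuclideanSpace ℝ (Fin M)) : smoothObjective W ν lam = fun p =>
      entropicObjective (fun i => ∑ j, W i j * lam j + -condEntropy W i) ν p +
        -(ν * Real.logb 2 N) := by
  funext p
  simp only [smoothObjective, linObjective, entropicObjective, sum_mul_output, add_mul,
    Finset.sum_add_distrib, neg_mul, Finset.sum_neg_distrib]
  ring

theorem isMaxOn_smoothObjective_iff {lam : EuclideanSpace ℝ (Fin M)} {K : Set (Fin N → ℝ)}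
    {p : Fin N → ℝ} : IsMaxOn (smoothObjective W ν lam) K p ↔
      IsMaxOn (entropicObjective (fun i => ∑ j, W i j * lam j + -condEntropy W i) ν) K p := by
  simp only [smoothObjective_eq_entropicObjective, isMaxOn_iff, add_le_add_iff_right]

theorem smoothMaximizer_spec (W : Matrix (Fin N) (Fin M) ℝ) (hc : (feasible c).Nonempty) (ν : ℝ)
    (lam : EuclideanSpace ℝ (Fin M)) : smoothMaximizer W c ν lam ∈ feasible c ∧
      IsMaxOn (smoothObjective W ν lam) (feasible c) (smoothMaximizer W c ν lam) := by
  refine Classical.epsilon_spec (p := fun p => p ∈ feasible c ∧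
    IsMaxOn (smoothObjective W ν lam) (feasible c) p) ?_
  simp only [isMaxOn_smoothObjective_iff]
  exact (isCompact_feasible c).exists_isMaxOn hc (by fun_prop)

theorem smoothMaximizer_mem (W : Matrix (Fin N) (Fin M) ℝ) (hc : (feasible c).Nonempty) (ν : ℝ)
    (lam : EuclideanSpace ℝ (Fin M)) : smoothMaximizer W c ν lam ∈ stdSimplex ℝ (Fin N) :=
  feasible_subset c (smoothMaximizer_spec W hc ν lam).1

theorem smoothMaximizer_none (hN : 0 < N) (W : Matrix (Fin N) (Fin M) ℝ) (hν : 0 < ν)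
    (lam : EuclideanSpace ℝ (Fin M)) : smoothMaximizer W none ν lam =
      gibbs fun i => (∑ j, W i j * lam j + -condEntropy W i) * Real.log 2 / ν := by
  have hgibbs := gibbs_mem_stdSimplex hN fun i =>
    (∑ j, W i j * lam j + -condEntropy W i) * Real.log 2 / ν
  have hmax := smoothMaximizer_spec W (c := none) ⟨_, hgibbs⟩ ν lam
  exact eq_of_isMaxOn_entropicObjective (convex_stdSimplex ℝ _) subset_rfl hν hmax.1
    (isMaxOn_smoothObjective_iff.1 hmax.2) hgibbs (isMaxOn_gibbs hN _ hν)

theorem isSmoothConvex_Gsmooth (hW : IsChannel W) (hc : (feasible c).Nonempty) (hν : 0 < ν) :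
    IsSmoothConvex (1 / ν) (Gsmooth W c ν) fun lam =>
      WithLp.toLp 2 (output W (smoothMaximizer W c ν lam)) := by
  have h := isSmoothConvex_sSup_entropicObjective (convex_feasible c) (feasible_subset c)
    hW.sum_abs_le hν (fun i => -condEntropy W i) (-(ν * Real.logb 2 N))
    (P := smoothMaximizer W c ν) (fun lam => (smoothMaximizer_spec W hc ν lam).1) fun lam => by
      simpa only [smoothObjective_eq_entropicObjective] using (smoothMaximizer_spec W hc ν lam).2
  simp only [← smoothObjective_eq_entropicObjective] at h
  exact h

theorem smoothGradient_eq (hM : 0 < M) (hW : IsChannel W) (hc : (feasible c).Nonempty)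
    (hν : 0 < ν) : smoothGradient W c ν = fun lam =>
      WithLp.toLp 2 (-outputMaximizer lam) +
        WithLp.toLp 2 (output W (smoothMaximizer W c ν lam)) := by
  funext lam
  rw [smoothGradient, ((isSmoothConvex_F hM).hasGradientAt lam).gradient,
    ((isSmoothConvex_Gsmooth hW hc hν).hasGradientAt lam).gradient]

theorem isSmoothConvex_smoothDual (hM : 0 < M) (hW : IsChannel W) (hc : (feasible c).Nonempty)
    (hν : 0 < ν) :
    IsSmoothConvex (1 + 1 / ν) (fun lam => F lam + Gsmooth W c ν lam) (smoothGradient W c ν) := by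
  rw [smoothGradient_eq hM hW hc hν]
  exact (isSmoothConvex_F hM).add (isSmoothConvex_Gsmooth hW hc hν)

theorem smoothGradient_apply (hM : 0 < M) (hW : IsChannel W) (hc : (feasible c).Nonempty)
    (hν : 0 < ν) (x : EuclideanSpace ℝ (Fin M)) (j : Fin M) :
    smoothGradient W c ν x j = output W (smoothMaximizer W c ν x) j - outputMaximizer x j := by
  rw [smoothGradient_eq hM hW hc hν]
  simp [sub_eq_neg_add]

theorem Gsmooth_eq (W : Matrix (Fin N) (Fin M) ℝ) (hc : (feasible c).Nonempty) (ν : ℝ)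
    (x : EuclideanSpace ℝ (Fin M)) :
    Gsmooth W c ν x = smoothObjective W ν x (smoothMaximizer W c ν x) :=
  sSup_image_eq_of_isMaxOn (smoothMaximizer_spec W hc ν x).1 (smoothMaximizer_spec W hc ν x).2

theorem smoothObjective_add_inner (W : Matrix (Fin N) (Fin M) ℝ) (ν : ℝ)
    (x y : EuclideanSpace ℝ (Fin M)) (p : Fin N → ℝ) :
    smoothObjective W ν x p + ⟪WithLp.toLp 2 (output W p), y - x⟫ = smoothObjective W ν y p := by
  rw [inner_sub_right, inner_toLp_output, inner_toLp_output, smoothObjective, smoothObjective,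
    linObjective, linObjective]
  ring

theorem smoothObjective_le_linObjective (W : Matrix (Fin N) (Fin M) ℝ) (hν : 0 ≤ ν)
    {p : Fin N → ℝ} (hp : p ∈ stdSimplex ℝ (Fin N)) (lam : EuclideanSpace ℝ (Fin M)) :
    smoothObjective W ν lam p ≤ linObjective W lam p := by
  have := mul_le_mul_of_nonneg_left (entropy_le_logb hp) hν
  rw [smoothObjective]
  linarith

/-- Linearizing at `x` costs at most the entropy term: the tangent plane of the smoothed dual
function at `x` is a lower bound for the Lagrangian at the maximizer `p_ν(x)`. -/
theorem smoothDual_add_inner_le (hM : 0 < M) (hW : IsChannel W) (hc : (feasible c).Nonempty)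
    (hν : 0 < ν) (x u : EuclideanSpace ℝ (Fin M)) :
    F x + Gsmooth W c ν x + ⟪smoothGradient W c ν x, u - x⟫ ≤
      F u + linObjective W u (smoothMaximizer W c ν x) := by
  have hF := (isSmoothConvex_F hM).add_inner_le x u
  have hG := smoothObjective_add_inner W ν x u (smoothMaximizer W c ν x)
  have hlin := smoothObjective_le_linObjective W hν.le (smoothMaximizer_mem W hc ν x) u
  rw [smoothGradient_eq hM hW hc hν, inner_add_left, Gsmooth_eq W hc]
  linarith

@[fun_prop]
theorem continuous_linObjective (W : Matrix (Fin N) (Fin M) ℝ) (lam : EuclideanSpace ℝ (Fin M)) :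
    Continuous (linObjective W lam) := by
  unfold linObjective
  fun_prop

theorem linObjective_le_G (W : Matrix (Fin N) (Fin M) ℝ) (lam : EuclideanSpace ℝ (Fin M))
    {p : Fin N → ℝ} (hp : p ∈ feasible c) : linObjective W lam p ≤ G W c lam :=
  le_csSup ((isCompact_feasible c).image (continuous_linObjective W lam)).bddAbove
    (Set.mem_image_of_mem _ hp)

theorem G_le_Gsmooth_add (W : Matrix (Fin N) (Fin M) ℝ) (hc : (feasible c).Nonempty)
    (hν : 0 ≤ ν) (lam : EuclideanSpace ℝ (Fin M)) :
    G W c lam ≤ Gsmooth W c ν lam + ν * D₂ N := by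
  refine csSup_le (hc.image _) (Set.forall_mem_image.2 fun p hp => ?_)
  have hmax : smoothObjective W ν lam p ≤ _ := (smoothMaximizer_spec W hc ν lam).2 hp
  rw [← Gsmooth_eq W hc, smoothObjective] at hmax
  have := mul_nonneg hν (entropy_nonneg (feasible_subset c hp))
  rw [D₂]
  linarith

end Dual

/-! ### Mutual information and duality -/

section Duality

variable {N M : ℕ} {W : Matrix (Fin N) (Fin M) ℝ} {p : Fin N → ℝ} {γ : ℝ}

theorem le_output (hγ : ∀ i j, γ ≤ W i j) (hp : p ∈ stdSimplex ℝ (Fin N)) (j : Fin M) :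
    γ ≤ output W p j := by
  calc γ = ∑ i, γ * p i := by rw [← Finset.mul_sum, hp.2, mul_one]
    _ ≤ output W p j := Finset.sum_le_sum fun i _ => mul_le_mul_of_nonneg_right (hγ i j) (hp.1 i)

theorem entropy_output (W : Matrix (Fin N) (Fin M) ℝ) (p : Fin N → ℝ) :
    entropy (output W p) = -∑ i, (∑ j, W i j * Real.logb 2 (output W p j)) * p i := by
  rw [← sum_mul_output, entropy, Finset.sum_neg_distrib]
  simp only [mul_comm]

theorem mutualInfo_eq (hpos : 0 < γ) (hγ : ∀ i j, γ ≤ W i j) (hp : p ∈ stdSimplex ℝ (Fin N)) :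
    mutualInfo p W = -(∑ i, condEntropy W i * p i) + entropy (output W p) := by
  rw [entropy_output, ← neg_add, ← Finset.sum_add_distrib, ← Finset.sum_neg_distrib, mutualInfo]
  refine Finset.sum_congr rfl fun i _ => ?_
  have hlog : ∀ j, W i j * Real.logb 2 (W i j / output W p j) =
      W i j * Real.logb 2 (W i j) - W i j * Real.logb 2 (output W p j) := fun j => by
    rw [Real.logb_div (hpos.trans_le (hγ i j)).ne' (hpos.trans_le (le_output hγ hp j)).ne',
      mul_sub]
  simp only [hlog, Finset.sum_sub_distrib, condEntropy]
  ring

theorem entropy_sub_le_F (lam : EuclideanSpace ℝ (Fin M)) {q : Fin M → ℝ}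
    (hq : q ∈ stdSimplex ℝ (Fin M)) : entropy q - ∑ j, lam j * q j ≤ F lam :=
  le_csSup ((isCompact_stdSimplex ℝ (Fin M)).image (by fun_prop)).bddAbove
    (Set.mem_image_of_mem (fun q : Fin M → ℝ => entropy q - ∑ j, lam j * q j) hq)

theorem mutualInfo_le_dual (hW : IsChannel W) (hpos : 0 < γ) (hγ : ∀ i j, γ ≤ W i j)
    {c : Option ((Fin N → ℝ) × ℝ)} (hp : p ∈ feasible c) (lam : EuclideanSpace ℝ (Fin M)) :
    mutualInfo p W ≤ F lam + G W c lam := by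
  have hsimplex := feasible_subset c hp
  have hF := entropy_sub_le_F lam (hW.output_mem hsimplex)
  have hG := linObjective_le_G W lam hp
  rw [linObjective] at hG
  rw [mutualInfo_eq hpos hγ hsimplex]
  linarith

/-- The multiplier `-log (Wᵀ p)`, which closes the duality gap of `p`. -/
noncomputable def outputMultiplier (W : Matrix (Fin N) (Fin M) ℝ) (p : Fin N → ℝ) :
    EuclideanSpace ℝ (Fin M) :=
  WithLp.toLp 2 fun j => -Real.logb 2 (output W p j)

theorem linObjective_outputMultiplier (hpos : 0 < γ) (hγ : ∀ i j, γ ≤ W i j)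
    (hp : p ∈ stdSimplex ℝ (Fin N)) :
    linObjective W (outputMultiplier W p) p = mutualInfo p W := by
  rw [mutualInfo_eq hpos hγ hp, linObjective, entropy]
  congr 1
  exact Finset.sum_congr rfl fun j _ => by simp only [outputMultiplier]; ring

theorem F_outputMultiplier_nonpos (hW : IsChannel W) (hpos : 0 < γ) (hγ : ∀ i j, γ ≤ W i j)
    (hp : p ∈ stdSimplex ℝ (Fin N)) : F (outputMultiplier W p) ≤ 0 := by
  have houtput := hW.output_mem hp
  refine csSup_le (Set.Nonempty.image _ ⟨_, houtput⟩) (Set.forall_mem_image.2 fun q hq => ?_)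
  have hcross := entropy_le_crossEntropy hq houtput fun j => hpos.trans_le (le_output hγ hp j)
  have hmultiplier : ∑ j, outputMultiplier W p j * q j =
      -∑ j, q j * Real.logb 2 (output W p j) := by
    simp only [outputMultiplier, neg_mul, Finset.sum_neg_distrib, mul_comm (q _)]
  change entropy q - ∑ j, outputMultiplier W p j * q j ≤ 0
  rw [hmultiplier]
  linarith

theorem norm_sq_outputMultiplier_le (hW : IsChannel W) (hpos : 0 < γ)
    (hγ : ∀ i j, γ ≤ W i j) (hp : p ∈ stdSimplex ℝ (Fin N)) :
    ‖outputMultiplier W p‖ ^ 2 ≤ M * Real.logb 2 γ⁻¹ ^ 2 := by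
  have houtput := hW.output_mem hp
  have hcoord : ∀ j, ‖outputMultiplier W p j‖ ^ 2 ≤ Real.logb 2 γ⁻¹ ^ 2 := fun j => by
    have hle_one : output W p j ≤ 1 := (mem_Icc_of_mem_stdSimplex houtput j).2
    have hnonpos := Real.logb_nonpos one_lt_two (houtput.1 j) hle_one
    have hge := Real.logb_le_logb_of_le one_lt_two hpos (le_output hγ hp j)
    simp only [outputMultiplier, norm_neg, Real.norm_eq_abs, sq_abs, Real.logb_inv, neg_sq]
    nlinarith
  rw [EuclideanSpace.norm_sq_eq]
  exact (Finset.sum_le_sum fun j _ => hcoord j).trans_eq (by simp)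

end Duality

/-! ### The duality gap of the output -/

section Parameters

variable {N M : ℕ}

theorem D₁_pos (M : ℕ) (γ : ℝ) : 0 < D₁ M γ := by
  have hlog : 0 < 1 / Real.log 2 := one_div_pos.2 (Real.log_pos one_lt_two)
  exact mul_pos one_half_pos (pow_pos (lt_max_of_lt_right hlog) 2)

theorem one_le_D₂ (hN : 2 ≤ N) : 1 ≤ D₂ N := by
  have h : Real.logb 2 2 ≤ Real.logb 2 N :=
    Real.logb_le_logb_of_le one_lt_two two_pos (by exact_mod_cast hN)
  rwa [Real.logb_self_eq_one one_lt_two] at h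

theorem D₂_pos (hN : 2 ≤ N) : 0 < D₂ N := one_pos.trans_le (one_le_D₂ hN)

theorem smoothing_pos (hN : 2 ≤ N) (M : ℕ) (γ : ℝ) (n : ℕ) : 0 < smoothing N M γ n := by
  have hD₁ := D₁_pos M γ
  have hD₂ := D₂_pos hN
  unfold smoothing
  positivity

theorem smoothing_le (hN : 2 ≤ N) (M : ℕ) (γ : ℝ) (n : ℕ) :
    smoothing N M γ n ≤ 2 / ((n : ℝ) + 1) * √(D₁ M γ) := by
  unfold smoothing
  gcongr
  exact div_le_self (D₁_pos M γ).le (one_le_D₂ hN)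

/-- The smoothing parameter balances the smoothing error `ν D₂` against the optimization error,
which is proportional to `1 + 1 / ν`. -/
theorem smoothing_mul_D₂_add (hN : 2 ≤ N) (M : ℕ) (γ : ℝ) (n : ℕ) :
    smoothing N M γ n * D₂ N + 4 * ((1 + 1 / smoothing N M γ n) * D₁ M γ) / ((n : ℝ) + 1) ^ 2 =
      4 / ((n : ℝ) + 1) * √(D₁ M γ * D₂ N) + 4 * D₁ M γ / ((n : ℝ) + 1) ^ 2 := by
  obtain ⟨a, ha, hD₁⟩ : ∃ a > 0, D₁ M γ = a ^ 2 :=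
    ⟨√(D₁ M γ), Real.sqrt_pos.2 (D₁_pos M γ), (Real.sq_sqrt (D₁_pos M γ).le).symm⟩
  obtain ⟨b, hb, hD₂⟩ : ∃ b > 0, D₂ N = b ^ 2 :=
    ⟨√(D₂ N), Real.sqrt_pos.2 (D₂_pos hN), (Real.sq_sqrt (D₂_pos hN).le).symm⟩
  have hdiv : √(a ^ 2 / b ^ 2) = a / b := by
    rw [← div_pow, Real.sqrt_sq (by positivity)]
  have hmul : √(a ^ 2 * b ^ 2) = a * b := by
    rw [← mul_pow, Real.sqrt_sq (by positivity)]
  rw [smoothing, hD₁, hD₂, hdiv, hmul]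
  field_simp
  ring

theorem radius_nonneg (M : ℕ) (γ : ℝ) : 0 ≤ radius M γ :=
  mul_nonneg M.cast_nonneg
    (le_max_of_le_right (one_div_nonneg.2 (Real.log_nonneg one_le_two)))

theorem log_two_inv_le : 1 / Real.log 2 ≤ 3 / 2 := by
  rw [div_le_div_iff₀ (Real.log_pos one_lt_two) two_pos]
  linarith [Real.log_two_gt_d9]

theorem weight_eq (n k : ℕ) : 2 * ((k : ℝ) + 1) / (((n : ℝ) + 1) * ((n : ℝ) + 2)) =
    (totalWeight n)⁻¹ * (((k : ℝ) + 1) / 2) := by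
  rw [totalWeight]
  field_simp
  ring

end Parameters

section Gap

variable {N M : ℕ} {W : Matrix (Fin N) (Fin M) ℝ} {c : Option ((Fin N → ℝ) × ℝ)} {γ ν : ℝ}
  {x₀ u : EuclideanSpace ℝ (Fin M)}

theorem IsChannel.output_pos (hW : IsChannel W) (hN : 0 < N) : 0 < M := by
  rcases Nat.eq_zero_or_pos M with rfl | hM
  · simpa using hW.row_sum ⟨0, hN⟩
  · exact hM

theorem pHat_mem_feasible (W : Matrix (Fin N) (Fin M) ℝ) (hc : (feasible c).Nonempty) (γ : ℝ)
    (x₀ : EuclideanSpace ℝ (Fin M)) (n : ℕ) : pHat W c γ x₀ n ∈ feasible c := by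
  refine (convex_feasible c).sum_mem (fun k _ => by positivity) ?_
    fun k _ => (smoothMaximizer_spec W hc _ _).1
  simp only [weight_eq, ← Finset.mul_sum, sum_weights]
  exact inv_mul_cancel₀ (totalWeight_pos n).ne'

theorem lamHat_mem_Q (W : Matrix (Fin N) (Fin M) ℝ) (c : Option ((Fin N → ℝ) × ℝ)) (γ : ℝ)
    (x₀ : EuclideanSpace ℝ (Fin M)) (n : ℕ) : lamHat W c γ x₀ n ∈ Q M γ :=
  norm_proj_le (radius_nonneg M γ) _

theorem linObjective_sum_smul (W : Matrix (Fin N) (Fin M) ℝ) (lam : EuclideanSpace ℝ (Fin M))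
    {ι : Type*} (s : Finset ι) (w : ι → ℝ) (p : ι → Fin N → ℝ) :
    linObjective W lam (∑ k ∈ s, w k • p k) = ∑ k ∈ s, w k * linObjective W lam (p k) := by
  have hsum : ∀ q : Fin N → ℝ, linObjective W lam q =
      ∑ i, (-condEntropy W i + ∑ j, W i j * lam j) * q i := fun q => by
    simp only [linObjective, sum_mul_output, add_mul, neg_mul, Finset.sum_add_distrib,
      Finset.sum_neg_distrib]
  simp only [hsum, Finset.sum_apply, Pi.smul_apply, smul_eq_mul, Finset.mul_sum]
  rw [Finset.sum_comm]
  exact Finset.sum_congr rfl fun k _ => Finset.sum_congr rfl fun i _ => by ring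

theorem norm_sq_smoothGradient_le (hM : 0 < M) (hW : IsChannel W) (hc : (feasible c).Nonempty)
    (hν : 0 < ν) (x : EuclideanSpace ℝ (Fin M)) : ‖smoothGradient W c ν x‖ ^ 2 ≤ 2 := by
  have ha := hW.output_mem (smoothMaximizer_mem W hc ν x)
  have hb : outputMaximizer x ∈ stdSimplex ℝ (Fin M) := gibbs_mem_stdSimplex hM _
  rw [EuclideanSpace.norm_sq_eq]
  simp only [smoothGradient_apply hM hW hc hν, Real.norm_eq_abs, sq_abs]
  set a := output W (smoothMaximizer W c ν x)
  set b := outputMaximizer x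
  calc ∑ j, (a j - b j) ^ 2 ≤ ∑ j, (a j + b j) := by
        refine Finset.sum_le_sum fun j _ => ?_
        obtain ⟨ha₀, ha₁⟩ := mem_Icc_of_mem_stdSimplex ha j
        obtain ⟨hb₀, hb₁⟩ := mem_Icc_of_mem_stdSimplex hb j
        nlinarith [mul_nonneg ha₀ hb₀]
    _ = 2 := by rw [Finset.sum_add_distrib, ha.2, hb.2]; norm_num

theorem startError_le (hM : 0 < M) (hW : IsChannel W) (hc : (feasible c).Nonempty)
    (hν : 0 < ν) (x : EuclideanSpace ℝ (Fin M)) {R : ℝ} (hR : 0 ≤ R) :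
    ‖smoothGradient W c ν x‖ * R / 2 + ‖smoothGradient W c ν x‖ ^ 2 / (8 * (1 + 1 / ν)) ≤
      71 / 100 * R + 1 / 4 := by
  have hsq := norm_sq_smoothGradient_le hM hW hc hν x
  have hnorm : ‖smoothGradient W c ν x‖ ≤ 71 / 50 :=
    (abs_le_of_sq_le_sq' (by linarith) (by norm_num)).2
  have hinv : 0 < 1 / ν := one_div_pos.2 hν
  have hfirst := mul_le_mul_of_nonneg_right hnorm hR
  have hsecond : ‖smoothGradient W c ν x‖ ^ 2 / (8 * (1 + 1 / ν)) ≤ 1 / 4 := by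
    rw [div_le_div_iff₀ (by linarith) (by norm_num)]
    linarith
  linarith

theorem estimate_le (hN : 2 ≤ N) (hW : IsChannel W) (hc : (feasible c).Nonempty) (γ : ℝ)
    (x₀ u : EuclideanSpace ℝ (Fin M)) (n : ℕ) :
    estimate (fun lam => F lam + Gsmooth W c (smoothing N M γ n) lam)
        (smoothGradient W c (smoothing N M γ n)) (1 + 1 / smoothing N M γ n) (radius M γ) x₀ n u ≤
      totalWeight n * (F u + linObjective W u (pHat W c γ x₀ n)) +
        (1 + 1 / smoothing N M γ n) / 2 * ‖u‖ ^ 2 := by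
  have hM := hW.output_pos (by omega)
  have hν := smoothing_pos hN M γ n
  have haverage : totalWeight n * linObjective W u (pHat W c γ x₀ n) =
      ∑ k ∈ Finset.range (n + 1), ((k : ℝ) + 1) / 2 * linObjective W u
        (smoothMaximizer W c (smoothing N M γ n) (queryPoint W c γ x₀ n k)) := by
    rw [pHat, linObjective_sum_smul, Finset.mul_sum]
    refine Finset.sum_congr rfl fun k _ => ?_
    rw [weight_eq, ← mul_assoc, mul_inv_cancel_left₀ (totalWeight_pos n).ne']
  rw [estimate, add_comm, mul_add, haverage, ← sum_weights, Finset.sum_mul,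
    ← Finset.sum_add_distrib]
  gcongr with k
  rw [← mul_add]
  exact mul_le_mul_of_nonneg_left
    (smoothDual_add_inner_le hM hW hc hν (queryPoint W c γ x₀ n k) u) (by positivity)

theorem smoothDual_lamHat_le (hN : 2 ≤ N) (hW : IsChannel W) (hc : (feasible c).Nonempty) (n : ℕ)
    (hx₀ : x₀ ∈ Q M γ) (hu : u ∈ Q M γ) :
    F (lamHat W c γ x₀ n) + Gsmooth W c (smoothing N M γ n) (lamHat W c γ x₀ n) ≤
      F u + linObjective W u (pHat W c γ x₀ n) +
        ((1 + 1 / smoothing N M γ n) / 2 * ‖u‖ ^ 2 + (71 / 100 * radius M γ + 1 / 4)) /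
          totalWeight n := by
  have hM := hW.output_pos (by omega)
  have hν := smoothing_pos hN M γ n
  have hscheme := totalWeight_mul_schemeY_le_estimate (radius_nonneg M γ) (by positivity)
    (isSmoothConvex_smoothDual hM hW hc hν) hx₀ n hu
  have hestimate := estimate_le hN hW hc γ x₀ u n
  have hstart := startError_le hM hW hc hν x₀ (radius_nonneg M γ)
  refine le_of_mul_le_mul_left ?_ (totalWeight_pos n)
  rw [mul_add _ (_ + _), mul_div_cancel₀ _ (totalWeight_pos n).ne']
  rw [← lamHat] at hscheme
  linarith

theorem gap_le_of_outputMultiplier_mem (hN : 2 ≤ N) (hW : IsChannel W) (hpos : 0 < γ)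
    (hγ : ∀ i j, γ ≤ W i j) (hc : (feasible c).Nonempty) (n : ℕ) (hx₀ : x₀ ∈ Q M γ)
    (hu : outputMultiplier W (pHat W c γ x₀ n) ∈ Q M γ) :
    F (lamHat W c γ x₀ n) + G W c (lamHat W c γ x₀ n) - mutualInfo (pHat W c γ x₀ n) W ≤
      smoothing N M γ n * D₂ N + ((1 + 1 / smoothing N M γ n) / 2 *
        ‖outputMultiplier W (pHat W c γ x₀ n)‖ ^ 2 + (71 / 100 * radius M γ + 1 / 4)) /
          totalWeight n := by
  have hp := feasible_subset c (pHat_mem_feasible W hc γ x₀ n)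
  have hsmooth := smoothDual_lamHat_le hN hW hc n hx₀ hu
  have hG := G_le_Gsmooth_add W hc (smoothing_pos hN M γ n).le (lamHat W c γ x₀ n)
  rw [linObjective_outputMultiplier hpos hγ hp] at hsmooth
  linarith [F_outputMultiplier_nonpos hW hpos hγ hp]

theorem one_le_logb_inv (hN : 0 < N) (hM : 2 ≤ M) (hW : IsChannel W) (hpos : 0 < γ)
    (hγ : ∀ i j, γ ≤ W i j) : 1 ≤ Real.logb 2 γ⁻¹ := by
  have hrow : (M : ℝ) * γ ≤ 1 := by
    rw [← hW.row_sum ⟨0, hN⟩]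
    calc (M : ℝ) * γ = ∑ _j : Fin M, γ := by simp
      _ ≤ _ := Finset.sum_le_sum fun j _ => hγ _ j
  have hM' : (2 : ℝ) ≤ M := by exact_mod_cast hM
  rw [Real.le_logb_iff_rpow_le one_lt_two (inv_pos.2 hpos), Real.rpow_one, ← one_div,
    le_div_iff₀ hpos]
  exact (mul_le_mul_of_nonneg_right hM' hpos.le).trans hrow

theorem D₁_eq (hM : 2 ≤ M) (hl : 1 ≤ Real.logb 2 γ⁻¹) :
    D₁ M γ = (M * Real.logb 2 γ⁻¹) ^ 2 / 2 := by
  have hM' : (2 : ℝ) ≤ M := by exact_mod_cast hM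
  rw [D₁, max_eq_left (log_two_inv_le.trans (by nlinarith))]
  ring

theorem le_radius (M : ℕ) (γ : ℝ) : M * Real.logb 2 γ⁻¹ ≤ radius M γ :=
  mul_le_mul_of_nonneg_left (le_max_left _ _) M.cast_nonneg

theorem radius_le (M : ℕ) (hl : 1 ≤ Real.logb 2 γ⁻¹) :
    radius M γ ≤ 3 / 2 * (M * Real.logb 2 γ⁻¹) := by
  have hmax : max (Real.logb 2 γ⁻¹) (1 / Real.log 2) ≤ 3 / 2 * Real.logb 2 γ⁻¹ :=
    max_le (by linarith) (log_two_inv_le.trans (by linarith))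
  calc radius M γ ≤ M * (3 / 2 * Real.logb 2 γ⁻¹) :=
        mul_le_mul_of_nonneg_left hmax M.cast_nonneg
    _ = 3 / 2 * (M * Real.logb 2 γ⁻¹) := by ring

/-- The constant `119 / 100` comes from the loss `71 / 100 * R + 1 / 4` at the start, since
`R ≤ 3 / 2 * K` and `2 ≤ K`. -/
theorem startError_absorbed {K L m : ℝ} (hK : 2 ≤ K) (hm : 1 ≤ m)
    (hL : 1 + 7 / 10 * m / K ≤ L) :
    (L / 2 * (K ^ 2 / 2) + 119 / 100 * K) / (m * (m + 1) / 4) ≤ 4 * (L * (K ^ 2 / 2)) / m ^ 2 := by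
  have hweight : 0 ≤ K * (m + 2) / 4 := by positivity
  have hstep : 119 / 100 * m ≤ (1 + 7 / 10 * m / K) * (K * (m + 2) / 4) := by
    have hexpand : (1 + 7 / 10 * m / K) * (K * (m + 2) / 4) =
        K * (m + 2) / 4 + 7 / 40 * (m * (m + 2)) := by
      field_simp
      ring
    rw [hexpand]
    nlinarith [sq_nonneg (m - 1)]
  have hnum : m * (L / 2 * (K ^ 2 / 2) + 119 / 100 * K) ≤ L * (K ^ 2 / 2) * (m + 1) := by
    nlinarith [mul_le_mul_of_nonneg_left (hstep.trans (mul_le_mul_of_nonneg_right hL hweight))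
      (by linarith : (0 : ℝ) ≤ K)]
  rw [div_le_div_iff₀ (by positivity) (by positivity)]
  nlinarith [mul_le_mul_of_nonneg_left hnum (by linarith : (0 : ℝ) ≤ m)]

theorem one_div_smoothing_ge (hN : 2 ≤ N) (hM : 2 ≤ M) (hl : 1 ≤ Real.logb 2 γ⁻¹) (n : ℕ) :
    7 / 10 * ((n : ℝ) + 1) / (M * Real.logb 2 γ⁻¹) ≤ 1 / smoothing N M γ n := by
  have hK : 0 < M * Real.logb 2 γ⁻¹ := by positivity
  have hsqrt : √(D₁ M γ) ≤ 71 / 100 * (M * Real.logb 2 γ⁻¹) := by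
    rw [D₁_eq hM hl]
    exact Real.sqrt_le_iff.2 ⟨by positivity, by nlinarith⟩
  rw [div_le_div_iff₀ hK (smoothing_pos hN M γ n), one_mul]
  calc 7 / 10 * ((n : ℝ) + 1) * smoothing N M γ n ≤
        7 / 10 * ((n : ℝ) + 1) *
          (2 / ((n : ℝ) + 1) * (71 / 100 * (M * Real.logb 2 γ⁻¹))) := by
        gcongr
        exact (smoothing_le hN M γ n).trans (by gcongr)
    _ = 994 / 1000 * (M * Real.logb 2 γ⁻¹) := by field_simp; ring
    _ ≤ M * Real.logb 2 γ⁻¹ := by linarith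

theorem gap_le_of_two_le (hN : 2 ≤ N) (hM : 2 ≤ M) (hW : IsChannel W) (hpos : 0 < γ)
    (hγ : ∀ i j, γ ≤ W i j) (hc : (feasible c).Nonempty) (n : ℕ) (hx₀ : x₀ ∈ Q M γ) :
    F (lamHat W c γ x₀ n) + G W c (lamHat W c γ x₀ n) - mutualInfo (pHat W c γ x₀ n) W ≤
      4 / ((n : ℝ) + 1) * √(D₁ M γ * D₂ N) + 4 * D₁ M γ / ((n : ℝ) + 1) ^ 2 := by
  have hl := one_le_logb_inv (by omega) hM hW hpos hγ
  have hM' : (2 : ℝ) ≤ M := by exact_mod_cast hM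
  have hK : 2 ≤ M * Real.logb 2 γ⁻¹ := by nlinarith
  have hnorm : ‖outputMultiplier W (pHat W c γ x₀ n)‖ ^ 2 ≤ D₁ M γ := by
    refine (norm_sq_outputMultiplier_le hW hpos hγ
      (feasible_subset c (pHat_mem_feasible W hc γ x₀ n))).trans ?_
    rw [D₁_eq hM hl]
    nlinarith [mul_le_mul_of_nonneg_left hM'
      (by positivity : (0 : ℝ) ≤ M * Real.logb 2 γ⁻¹ ^ 2)]
  have hmem : outputMultiplier W (pHat W c γ x₀ n) ∈ Q M γ := by
    rw [D₁_eq hM hl] at hnorm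
    exact (abs_le_of_sq_le_sq' (by nlinarith) (by linarith)).2.trans (le_radius M γ)
  have hν := smoothing_pos hN M γ n
  refine (gap_le_of_outputMultiplier_mem hN hW hpos hγ hc n hx₀ hmem).trans ?_
  rw [← smoothing_mul_D₂_add hN]
  refine add_le_add le_rfl ?_
  have habsorbed := startError_absorbed hK (by simp : (1 : ℝ) ≤ (n : ℝ) + 1)
    (add_le_add le_rfl (one_div_smoothing_ge hN hM hl n))
  have hweight : ((n : ℝ) + 1) * ((n : ℝ) + 1 + 1) / 4 = totalWeight n := by
    rw [totalWeight]; ring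
  rw [← D₁_eq hM hl, hweight] at habsorbed
  refine (div_le_div_of_nonneg_right (add_le_add ?_ ?_) (totalWeight_pos n).le).trans habsorbed
  · exact mul_le_mul_of_nonneg_left hnorm (by positivity)
  · linarith [radius_le M hl]

theorem gap_nonpos_of_one {W : Matrix (Fin N) (Fin 1) ℝ} (hW : IsChannel W)
    (hc : (feasible c).Nonempty) {p : Fin N → ℝ} (hp : p ∈ stdSimplex ℝ (Fin N))
    (lam : EuclideanSpace ℝ (Fin 1)) : F lam + G W c lam - mutualInfo p W ≤ 0 := by
  have hW_one : ∀ i, W i 0 = 1 := fun i => by simpa using hW.row_sum i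
  have houtput : ∀ q ∈ stdSimplex ℝ (Fin N), output W q 0 = 1 := fun q hq => by
    simpa [output, hW_one] using hq.2
  have hF : F lam ≤ -lam 0 := by
    refine csSup_le (Set.Nonempty.image _ ⟨_, hW.output_mem hp⟩)
      (Set.forall_mem_image.2 fun q hq => ?_)
    have hentropy := entropy_le_logb hq
    have hq_one : q 0 = 1 := by simpa using hq.2
    simp only [Nat.cast_one, Real.logb_one] at hentropy
    simpa [hq_one] using hentropy
  have hG : G W c lam ≤ lam 0 := by
    refine csSup_le (hc.image _) (Set.forall_mem_image.2 fun q hq => ?_)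
    simp [linObjective, condEntropy, hW_one, houtput q (feasible_subset c hq)]
  have hI : mutualInfo p W = 0 := by simp [mutualInfo, hW_one, houtput p hp]
  linarith

theorem gap_le (hN : 2 ≤ N) (hW : IsChannel W) (hpos : 0 < γ) (hγ : ∀ i j, γ ≤ W i j)
    (hc : (feasible c).Nonempty) (n : ℕ) (hx₀ : x₀ ∈ Q M γ) :
    F (lamHat W c γ x₀ n) + G W c (lamHat W c γ x₀ n) - mutualInfo (pHat W c γ x₀ n) W ≤
      4 / ((n : ℝ) + 1) * √(D₁ M γ * D₂ N) + 4 * D₁ M γ / ((n : ℝ) + 1) ^ 2 := by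
  have hM := hW.output_pos (by omega)
  obtain rfl | hM_two := (show M = 1 ∨ 2 ≤ M by omega)
  · have hD₁ := D₁_pos 1 γ
    exact (gap_nonpos_of_one hW hc (feasible_subset c (pHat_mem_feasible W hc γ x₀ n)) _).trans
      (by positivity)
  · exact gap_le_of_two_le hN hM_two hW hpos hγ hc n hx₀

theorem iterationBound_nonneg (N M : ℕ) (γ : ℝ) {ε : ℝ} (hε : 0 < ε) :
    0 ≤ iterationBound N M γ ε := by
  unfold iterationBound
  positivity

theorem gapBound_le_of_iterationBound_le {ε m : ℝ} (hN : 2 ≤ N) (hε : 0 < ε)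
    (hm : iterationBound N M γ ε ≤ m) :
    4 / m * √(D₁ M γ * D₂ N) + 4 * D₁ M γ / m ^ 2 ≤ ε := by
  have hD₁ := D₁_pos M γ
  have hT : 0 < √(D₁ M γ * D₂ N) := Real.sqrt_pos.2 (mul_pos hD₁ (D₂_pos hN))
  have hB : 0 < √(D₁ M γ / ε) := Real.sqrt_pos.2 (div_pos hD₁ hε)
  have hB_sq : D₁ M γ = √(D₁ M γ / ε) ^ 2 * ε := by
    rw [Real.sq_sqrt (div_pos hD₁ hε).le, div_mul_cancel₀ _ hε.ne']
  rw [iterationBound] at hm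
  set T := √(D₁ M γ * D₂ N)
  set B := √(D₁ M γ / ε)
  have hα : 0 < 4 * T * (1 / ε) := by positivity
  have hm_pos : 0 < m := by linarith
  calc 4 / m * T + 4 * D₁ M γ / m ^ 2 =
        ε * ((4 * T * (1 / ε) * m + (2 * B) ^ 2) / m ^ 2) := by rw [hB_sq]; field_simp; ring
    _ ≤ ε := mul_le_of_le_one_right hε.le ((div_le_one (by positivity)).2 (by nlinarith))

end Gap

/-! ### The capacity problems -/

theorem exists_mem_eq_of_concaveOn {E : Type*} [AddCommGroup E] [Module ℝ E] {K : Set E} {f : E → ℝ}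
    (hf : ConcaveOn ℝ K f) (ℓ : E →ₗ[ℝ] ℝ) {x y : E} (hx : x ∈ K) (hy : y ∈ K) {S : ℝ}
    (hxS : ℓ x ≤ S) (hSy : S ≤ ℓ y) (hxy : f x ≤ f y) : ∃ z ∈ K, ℓ z = S ∧ f x ≤ f z := by
  obtain ⟨z, hz, rfl⟩ : S ∈ ℓ '' segment ℝ x y := by
    rw [← LinearMap.coe_toAffineMap, image_segment, LinearMap.coe_toAffineMap,
      segment_eq_Icc (hxS.trans hSy)]
    exact ⟨hxS, hSy⟩
  exact ⟨z, hf.1.segment_subset hx hy hz, rfl,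
    (le_min le_rfl hxy).trans (hf.ge_on_segment hx hy hz)⟩

theorem concaveOn_entropy {d : ℕ} : ConcaveOn ℝ (stdSimplex ℝ (Fin d)) entropy :=
  (strongConcaveOn_entropy.concaveOn fun _ => by positivity).comp_linearMap
    (WithLp.linearEquiv 1 ℝ (Fin d → ℝ)).symm.toLinearMap

section Capacity

variable {N M : ℕ} {W : Matrix (Fin N) (Fin M) ℝ} {γ : ℝ} {c : Option ((Fin N → ℝ) × ℝ)}

theorem continuousOn_mutualInfo (hpos : 0 < γ) (hγ : ∀ i j, γ ≤ W i j) :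
    ContinuousOn (fun p => mutualInfo p W) (stdSimplex ℝ (Fin N)) := by
  have hcont : Continuous fun p : Fin N → ℝ =>
      -(∑ i, condEntropy W i * p i) + entropy (output W p) := by fun_prop
  exact hcont.continuousOn.congr fun p hp => mutualInfo_eq hpos hγ hp

theorem concaveOn_mutualInfo (hW : IsChannel W) (hpos : 0 < γ) (hγ : ∀ i j, γ ≤ W i j) :
    ConcaveOn ℝ (stdSimplex ℝ (Fin N)) fun p => mutualInfo p W := by
  have hlin : ConcaveOn ℝ (stdSimplex ℝ (Fin N)) fun p => -(∑ i, condEntropy W i * p i) :=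
    (-∑ i, condEntropy W i • LinearMap.proj (R := ℝ) (φ := fun _ : Fin N => ℝ) i).concaveOn
      (convex_stdSimplex ℝ _) |>.congr fun p _ => by simp
  have hentropy : ConcaveOn ℝ (stdSimplex ℝ (Fin N)) fun p => entropy (output W p) :=
    (concaveOn_entropy.comp_linearMap W.transpose.mulVecLin).subset
      (fun _ hp => hW.output_mem hp) (convex_stdSimplex ℝ _)
  exact (hlin.add hentropy).congr fun p hp => (mutualInfo_eq hpos hγ hp).symm

theorem exists_isMaxOn_cost_eq_costThreshold (hN : 0 < N) (hpos : 0 < γ)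
    (hγ : ∀ i j, γ ≤ W i j) (s : Fin N → ℝ) : ∃ p ∈ stdSimplex ℝ (Fin N),
      IsMaxOn (fun p => mutualInfo p W) (stdSimplex ℝ (Fin N)) p ∧
        ∑ i, s i * p i = costThreshold W s := by
  have hne : (stdSimplex ℝ (Fin N)).Nonempty := ⟨_, gibbs_mem_stdSimplex hN 0⟩
  have hcont := continuousOn_mutualInfo hpos hγ
  obtain ⟨p₀, hp₀, hmax⟩ := (isCompact_stdSimplex ℝ (Fin N)).exists_isMaxOn hne hcont
  have hmaximizers : {p | p ∈ stdSimplex ℝ (Fin N) ∧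
      ∀ p' ∈ stdSimplex ℝ (Fin N), mutualInfo p' W ≤ mutualInfo p W} =
      stdSimplex ℝ (Fin N) ∩ (fun p => mutualInfo p W) ⁻¹' Set.Ici (mutualInfo p₀ W) := by
    ext p
    exact ⟨fun h => ⟨h.1, h.2 p₀ hp₀⟩, fun h => ⟨h.1, fun p' hp' => (hmax hp').trans h.2⟩⟩
  have hcompact : IsCompact {p | p ∈ stdSimplex ℝ (Fin N) ∧
      ∀ p' ∈ stdSimplex ℝ (Fin N), mutualInfo p' W ≤ mutualInfo p W} := by
    rw [hmaximizers]
    exact (isCompact_stdSimplex ℝ (Fin N)).of_isClosed_subset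
      (hcont.preimage_isClosed_of_isClosed (isClosed_stdSimplex ℝ (Fin N)) isClosed_Ici)
      Set.inter_subset_left
  have hcost : Continuous fun p : Fin N → ℝ => ∑ i, s i * p i := by fun_prop
  obtain ⟨p, hp, hthreshold⟩ := (hcompact.image hcost).sInf_mem
    (Set.Nonempty.image _ ⟨p₀, hp₀, fun _ h => hmax h⟩)
  exact ⟨p, hp.1, hp.2, hthreshold⟩

theorem exists_mem_feasible_mutualInfo_ge (hN : 0 < N) (hW : IsChannel W) (hpos : 0 < γ)
    (hγ : ∀ i j, γ ≤ W i j) {s p : Fin N → ℝ} {S : ℝ} (hS : S ≤ costThreshold W s)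
    (hp : p ∈ stdSimplex ℝ (Fin N)) (hcost : ∑ i, s i * p i ≤ S) :
    ∃ p' ∈ feasible (some (s, S)), mutualInfo p W ≤ mutualInfo p' W := by
  obtain ⟨p₀, hp₀, hmax, hp₀_cost⟩ := exists_isMaxOn_cost_eq_costThreshold hN hpos hγ s
  obtain ⟨p', hp', hp'_cost, hle⟩ := exists_mem_eq_of_concaveOn
    (concaveOn_mutualInfo hW hpos hγ) (Fintype.linearCombination ℝ s) hp hp₀ (S := S)
    (by simpa [Fintype.linearCombination_apply, mul_comm] using hcost)
    (by simpa [Fintype.linearCombination_apply, mul_comm, hp₀_cost] using hS) (hmax hp)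
  exact ⟨p', ⟨hp', by simpa [Fintype.linearCombination_apply, mul_comm] using hp'_cost⟩, hle⟩

theorem isLUB_capacity (hN : 0 < N) (hW : IsChannel W) (hpos : 0 < γ) (hγ : ∀ i j, γ ≤ W i j)
    (hc : (feasible c).Nonempty) {s : Fin N → ℝ} {S : ℝ} (hr : Reformulates W c s S) :
    IsLUB ((fun p => mutualInfo p W) '' feasible c) (capacity W s S) := by
  obtain ⟨p₀, hp₀, hmax, hcost⟩ := exists_isMaxOn_cost_eq_costThreshold hN hpos hγ s
  have hle_capacity : ∀ p ∈ stdSimplex ℝ (Fin N), ∑ i, s i * p i ≤ S →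
      mutualInfo p W ≤ capacity W s S := fun p hp hpS =>
    le_csSup ⟨mutualInfo p₀ W, Set.forall_mem_image.2 fun q hq => hmax hq.1⟩
      (Set.mem_image_of_mem (fun p => mutualInfo p W) ⟨hp, hpS⟩)
  obtain ⟨hS, rfl⟩ | ⟨hS, rfl⟩ := hr
  · refine ⟨Set.forall_mem_image.2 fun p hp => hle_capacity p hp.1 hp.2.le, fun B hB => ?_⟩
    obtain ⟨q, hq, hqS⟩ := hc
    refine csSup_le (Set.Nonempty.image _ ⟨q, hq, hqS.le⟩) (Set.forall_mem_image.2 fun p hp => ?_)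
    obtain ⟨p', hp', hle⟩ := exists_mem_feasible_mutualInfo_ge hN hW hpos hγ hS.le hp.1 hp.2
    exact hle.trans (hB (Set.mem_image_of_mem _ hp'))
  · refine ⟨Set.forall_mem_image.2 fun p hp =>
      (hmax hp).trans (hle_capacity p₀ hp₀ (hcost.le.trans hS)), fun B hB => ?_⟩
    exact csSup_le (Set.Nonempty.image _ ⟨p₀, hp₀, hcost.le.trans hS⟩)
      (Set.forall_mem_image.2 fun p hp => hB (Set.mem_image_of_mem _ hp.1))

theorem isEpsSolution_of_gap_le (hN : 0 < N) (hW : IsChannel W) (hpos : 0 < γ)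
    (hγ : ∀ i j, γ ≤ W i j) {ε : ℝ} {lam : EuclideanSpace ℝ (Fin M)} {p : Fin N → ℝ}
    (hp : p ∈ feasible c) (hgap : F lam + G W c lam - mutualInfo p W ≤ ε) :
    IsEpsSolution W c ε lam p := by
  have hweak : ∀ p' ∈ feasible c, ∀ lam', mutualInfo p' W ≤ F lam' + G W c lam' :=
    fun p' hp' lam' => mutualInfo_le_dual hW hpos hγ hp' lam'
  have hlower : ∀ s S, Reformulates W c s S → mutualInfo p W ≤ capacity W s S :=
    fun s S hr => (isLUB_capacity hN hW hpos hγ ⟨p, hp⟩ hr).1 (Set.mem_image_of_mem _ hp)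
  have hupper : ∀ s S, Reformulates W c s S → capacity W s S ≤ F lam + G W c lam :=
    fun s S hr => (isLUB_capacity hN hW hpos hγ ⟨p, hp⟩ hr).2
      (Set.forall_mem_image.2 fun p' hp' => hweak p' hp' lam)
  exact
    { mem := hp
      gap := hgap
      dual := fun lam' => by linarith [hweak p hp lam']
      primal := fun p' hp' => by linarith [hweak p' hp' lam]
      capacity_lower := fun s S hr => ⟨hlower s S hr, by linarith [hupper s S hr]⟩
      capacity_upper := fun s S hr => ⟨hupper s S hr, by linarith [hlower s S hr]⟩ }

theorem isEpsSolution_of_floor_le (hN : 2 ≤ N) (hW : IsChannel W) (hpos : 0 < γ)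
    (hγ : ∀ i j, γ ≤ W i j) (hc : (feasible c).Nonempty) {ε : ℝ} (hε : 0 < ε) {n : ℕ}
    (hn : ⌊iterationBound N M γ ε⌋₊ ≤ n) {x₀ : EuclideanSpace ℝ (Fin M)} (hx₀ : x₀ ∈ Q M γ) :
    IsEpsSolution W c ε (lamHat W c γ x₀ n) (pHat W c γ x₀ n) := by
  have hbound : iterationBound N M γ ε ≤ (n : ℝ) + 1 := by
    exact_mod_cast (Nat.floor_lt (iterationBound_nonneg N M γ hε)).1 (Nat.lt_succ_of_le hn) |>.le
  exact isEpsSolution_of_gap_le (by omega) hW hpos hγ (pHat_mem_feasible W hc γ x₀ n)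
    ((gap_le hN hW hpos hγ hc n hx₀).trans (gapBound_le_of_iterationBound_le hN hε hbound))

end Capacity

/-! ### Straight-line programs -/

/-- Every straight-line computation that provides the values in `A` can be extended by at most `c`
operations to one that also provides those in `B`. -/
def ComputesFrom {ι : Type} (A B : Set ((ι → ℝ) → ℝ)) (c : ℕ) : Prop :=
  ∀ k S, StraightLine k S → A ⊆ S →
    ∃ l T, l ≤ k + c ∧ StraightLine l T ∧ S ⊆ T ∧ B ⊆ T

/-- The coordinates of a vector `w v` that depends on the input `v`, as real functions of `v`. -/
def coordinates {ι : Type} {n : ℕ} (w : (ι → ℝ) → Fin n → ℝ) : Set ((ι → ℝ) → ℝ) :=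
  Set.range fun i v => w v i

theorem mem_coordinates {ι : Type} {n : ℕ} {w : (ι → ℝ) → Fin n → ℝ} (i : Fin n) :
    (fun v => w v i) ∈ coordinates w := ⟨i, rfl⟩

theorem coordinates_subset_iff {ι : Type} {n : ℕ} {w : (ι → ℝ) → Fin n → ℝ}
    {A : Set ((ι → ℝ) → ℝ)} : coordinates w ⊆ A ↔ ∀ i, (fun v => w v i) ∈ A :=
  Set.range_subset_iff

namespace ComputesFrom

variable {ι : Type} {A B C : Set ((ι → ℝ) → ℝ)} {c d : ℕ} {f h : (ι → ℝ) → ℝ}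

theorem of_subset (hB : B ⊆ A) : ComputesFrom A B 0 := fun k S hS hA =>
  ⟨k, S, le_rfl, hS, subset_rfl, hB.trans hA⟩

theorem of_mem (hf : f ∈ A) : ComputesFrom A {f} 0 := of_subset (Set.singleton_subset_iff.2 hf)

theorem mono (hAB : ComputesFrom A B c) (hc : c ≤ d) : ComputesFrom A B d := fun k S hS hA =>
  let ⟨k', S', hk', hS'⟩ := hAB k S hS hA
  ⟨k', S', by omega, hS'⟩

theorem subset_right (hAB : ComputesFrom A B c) (hC : C ⊆ B) : ComputesFrom A C c :=
  fun k S hS hA =>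
    let ⟨k', S', hk', hS', hSS', hB⟩ := hAB k S hS hA
    ⟨k', S', hk', hS', hSS', hC.trans hB⟩

theorem subset_left (hAB : ComputesFrom A B c) (hC : A ⊆ C) : ComputesFrom C B c :=
  fun k S hS hA => hAB k S hS (hC.trans hA)

theorem bind (hAB : ComputesFrom A B c)
    (hBC : ∀ A', A ⊆ A' → B ⊆ A' → ComputesFrom A' C d) : ComputesFrom A C (c + d) := by
  intro k S hS hA
  obtain ⟨k₁, S₁, hk₁, hS₁, hSS₁, hB⟩ := hAB k S hS hA
  obtain ⟨k₂, S₂, hk₂, hS₂, hS₁S₂, hC⟩ := hBC S₁ (hA.trans hSS₁) hB k₁ S₁ hS₁ subset_rfl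
  exact ⟨k₂, S₂, by omega, hS₂, hSS₁.trans hS₁S₂, hC⟩

theorem union (hB : ComputesFrom A B c) (hC : ComputesFrom A C d) :
    ComputesFrom A (B ∪ C) (c + d) := by
  intro k S hS hA
  obtain ⟨k₁, S₁, hk₁, hS₁, hSS₁, hBS₁⟩ := hB k S hS hA
  obtain ⟨k₂, S₂, hk₂, hS₂, hS₁S₂, hCS₂⟩ := hC k₁ S₁ hS₁ (hA.trans hSS₁)
  exact ⟨k₂, S₂, by omega, hS₂, hSS₁.trans hS₁S₂, Set.union_subset (hBS₁.trans hS₁S₂) hCS₂⟩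

theorem const (a : ℕ) : ComputesFrom A {fun _ => (a : ℝ)} 1 := fun k S hS _ =>
  ⟨k + 1, _, le_rfl, hS.const a, Set.subset_insert _ _, by simp⟩

theorem unary {g : (ι → ℝ) → ℝ} (hf : ComputesFrom A {f} c)
    (step : ∀ k S, StraightLine k S → f ∈ S → StraightLine (k + 1) (insert g S)) :
    ComputesFrom A {g} (c + 1) :=
  hf.bind fun _ _ hB k S hS hA' => ⟨k + 1, _, le_rfl,
    step k S hS (hA' (hB rfl)), Set.subset_insert _ _, by simp⟩

theorem binary {g : (ι → ℝ) → ℝ} (hf : ComputesFrom A {f} c) (hh : ComputesFrom A {h} d)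
    (step : ∀ k S, StraightLine k S → f ∈ S → h ∈ S → StraightLine (k + 1) (insert g S)) :
    ComputesFrom A {g} (c + d + 1) :=
  (hf.union hh).bind fun _ _ hB k S hS hA' => ⟨k + 1, _, le_rfl,
    step k S hS (hA' (hB (Or.inl rfl))) (hA' (hB (Or.inr rfl))), Set.subset_insert _ _, by simp⟩

theorem add (hf : ComputesFrom A {f} c) (hh : ComputesFrom A {h} d) :
    ComputesFrom A {fun v => f v + h v} (c + d + 1) := hf.binary hh fun _ _ => .add

theorem sub (hf : ComputesFrom A {f} c) (hh : ComputesFrom A {h} d) :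
    ComputesFrom A {fun v => f v - h v} (c + d + 1) := hf.binary hh fun _ _ => .sub

theorem mul (hf : ComputesFrom A {f} c) (hh : ComputesFrom A {h} d) :
    ComputesFrom A {fun v => f v * h v} (c + d + 1) := hf.binary hh fun _ _ => .mul

theorem div (hf : ComputesFrom A {f} c) (hh : ComputesFrom A {h} d) :
    ComputesFrom A {fun v => f v / h v} (c + d + 1) := hf.binary hh fun _ _ => .div

theorem max (hf : ComputesFrom A {f} c) (hh : ComputesFrom A {h} d) :
    ComputesFrom A {fun v => Max.max (f v) (h v)} (c + d + 1) := hf.binary hh fun _ _ => .max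

theorem sqrt (hf : ComputesFrom A {f} c) : ComputesFrom A {fun v => √(f v)} (c + 1) :=
  hf.unary fun _ _ => .sqrt

theorem exp (hf : ComputesFrom A {f} c) : ComputesFrom A {fun v => Real.exp (f v)} (c + 1) :=
  hf.unary fun _ _ => .exp

theorem log (hf : ComputesFrom A {f} c) : ComputesFrom A {fun v => Real.log (f v)} (c + 1) :=
  hf.unary fun _ _ => .log

theorem congr {g : (ι → ℝ) → ℝ} (hf : ComputesFrom A {f} c) (hfg : ∀ v, f v = g v) :
    ComputesFrom A {g} c := by
  rwa [← funext hfg]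

theorem neg (hf : ComputesFrom A {f} c) : ComputesFrom A {fun v => -f v} (c + 2) :=
  (((const 0).sub hf).mono (by omega)).congr fun v => by simp

theorem inv (hf : ComputesFrom A {f} c) : ComputesFrom A {fun v => (f v)⁻¹} (c + 2) :=
  (((const 1).div hf).mono (by omega)).congr fun v => by simp

theorem coordinates {n : ℕ} {w : (ι → ℝ) → Fin n → ℝ}
    (hw : ∀ i, ComputesFrom A {fun v => w v i} c) :
    ComputesFrom A (DMC.coordinates w) (n * c) := by
  induction n with
  | zero => exact (of_subset (by simp [DMC.coordinates])).mono (Nat.zero_le _)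
  | succ n ih =>
    refine (((ih (w := fun v i => w v i.castSucc) fun i => hw i.castSucc).union
      (hw (Fin.last n))).mono (by rw [Nat.succ_mul])).subset_right (coordinates_subset_iff.2 ?_)
    exact Fin.lastCases (Or.inr rfl) fun i => Or.inl (mem_coordinates i)

theorem sum {n : ℕ} {F : Fin n → (ι → ℝ) → ℝ} (hF : ∀ i, ComputesFrom A {F i} c) :
    ComputesFrom A {fun v => ∑ i, F i v} (n * (c + 1) + 1) := by
  induction n with
  | zero => exact ((const 0).mono (by omega)).congr fun v => by simp
  | succ n ih =>
    refine (((ih fun i => hF i.castSucc).add (hF (Fin.last n))).mono ?_).congr fun v =>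
      (Fin.sum_univ_castSucc fun i => F i v).symm
    rw [Nat.succ_mul]
    omega

theorem gibbs {n : ℕ} {t : (ι → ℝ) → Fin n → ℝ} (ht : DMC.coordinates t ⊆ A) :
    ComputesFrom A (DMC.coordinates fun v => DMC.gibbs (t v)) (3 * n + 1) := by
  have hexp : ComputesFrom A (DMC.coordinates fun v i => Real.exp (t v i)) (n * 1) :=
    coordinates fun i => (of_mem (ht (mem_coordinates i))).exp
  refine (hexp.bind (d := 2 * n + 1) fun A₁ _ hA₁ => ?_).mono (by omega)
  have hsum : ComputesFrom A₁ {fun v => ∑ i, Real.exp (t v i)} (n * 1 + 1) :=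
    sum fun i => of_mem (hA₁ (mem_coordinates i))
  refine (hsum.bind (d := n * 1) fun A₂ hA₂ hsum_mem => ?_).mono (by omega)
  exact coordinates fun i => (of_mem (hA₂ (hA₁ (mem_coordinates i)))).div (of_mem (hsum_mem rfl))

end ComputesFrom

section Projection

variable {M : ℕ}

theorem proj_eq_smul {R : ℝ} (hR : 0 ≤ R) (x : EuclideanSpace ℝ (Fin M)) :
    proj R x = (R / max R ‖x‖) • x := by
  unfold proj
  split_ifs with hx
  · rw [max_eq_right hx.le]
  · rw [max_eq_left (not_lt.1 hx)]
    obtain rfl | hR_ne := eq_or_ne R 0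
    · rw [norm_le_zero_iff.1 (not_lt.1 hx), smul_zero]
    · rw [div_self hR_ne, one_smul]

theorem ComputesFrom.proj {ι : Type} {A : Set ((ι → ℝ) → ℝ)} {R : (ι → ℝ) → ℝ}
    (hR : R ∈ A) (hnonneg : ∀ v, 0 ≤ R v) {w : (ι → ℝ) → EuclideanSpace ℝ (Fin M)} {c : ℕ}
    (hw : ∀ j, ComputesFrom A {fun v => w v j} c) :
    ComputesFrom A (DMC.coordinates fun v j => DMC.proj (R v) (w v) j) (M * c + 3 * M + 4) := by
  refine ((coordinates hw).bind (d := 3 * M + 4) fun A₁ hA₁ hw₁ => ?_).mono (by omega)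
  have hw_mem : ∀ j, (fun v => w v j) ∈ A₁ := coordinates_subset_iff.1 hw₁
  have hnorm : ComputesFrom A₁ {fun v => ‖w v‖} (2 * M + 2) :=
    ((sum fun j => (of_mem (hw_mem j)).mul (of_mem (hw_mem j))).sqrt.mono (by omega)).congr
      fun v => by simp only [EuclideanSpace.norm_eq, Real.norm_eq_abs, sq, abs_mul_abs_self]
  have hfactor : ComputesFrom A₁ {fun v => R v / Max.max (R v) ‖w v‖} (2 * M + 4) :=
    ((of_mem (hA₁ hR)).div ((of_mem (hA₁ hR)).max hnorm)).mono (by omega)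
  refine (hfactor.bind (d := M * 1) fun A₂ hA₂ hfactor_mem => ?_).mono (by omega)
  exact coordinates fun j =>
    ((of_mem (hfactor_mem rfl)).mul (of_mem (hA₂ (hw_mem j)))).congr fun v => by
      rw [proj_eq_smul (hnonneg v)]
      rfl

end Projection

/-! ### The algorithm as a straight-line program -/

section Program

variable {N M : ℕ}

/-- The smoothed maximizer without cost constraint, in closed form. -/
noncomputable def inputGibbs (W : Matrix (Fin N) (Fin M) ℝ) (ν : ℝ)
    (x : EuclideanSpace ℝ (Fin M)) : Fin N → ℝ :=
  gibbs fun i => (∑ j, W i j * x j + -condEntropy W i) * Real.log 2 / ν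

/-- The gradient of the smoothed dual function without cost constraint, in closed form. -/
noncomputable def gibbsGradient (W : Matrix (Fin N) (Fin M) ℝ) (ν : ℝ)
    (x : EuclideanSpace ℝ (Fin M)) : EuclideanSpace ℝ (Fin M) :=
  WithLp.toLp 2 fun j => output W (inputGibbs W ν x) j - outputMaximizer x j

theorem smoothGradient_none (hN : 0 < N) (hM : 0 < M) {W : Matrix (Fin N) (Fin M) ℝ}
    (hW : IsChannel W) {ν : ℝ} (hν : 0 < ν) : smoothGradient W none ν = gibbsGradient W ν := by
  funext x
  ext j
  rw [smoothGradient_apply hM hW ⟨_, gibbs_mem_stdSimplex hN 0⟩ hν, smoothMaximizer_none hN W hν]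
  rfl

/-- The input of the algorithm: a channel matrix, a starting point and a lower bound on the entries
of the matrix, in the layout of `encode`. -/
abbrev Data (N M : ℕ) : Type := (Fin N × Fin M) ⊕ Fin M ⊕ Unit → ℝ

namespace Data

/-- The channel matrix stored in the input. -/
def channel (v : Data N M) : Matrix (Fin N) (Fin M) ℝ := Matrix.of fun i j => v (Sum.inl (i, j))

/-- The starting point `x₀` stored in the input. -/
noncomputable def start (v : Data N M) : EuclideanSpace ℝ (Fin M) :=
  WithLp.toLp 2 fun j => v (Sum.inr (Sum.inl j))

/-- The lower bound `γ` stored in the input. -/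
def floor (v : Data N M) : ℝ := v (Sum.inr (Sum.inr ()))

/-- The smoothing parameter `ν` for `n` iterations, as a function of the input. -/
noncomputable def smoothing (v : Data N M) (n : ℕ) : ℝ := DMC.smoothing N M v.floor n

/-- The state of the fast gradient scheme run with the closed-form gradients. -/
noncomputable def state (v : Data N M) (n k : ℕ) :
    EuclideanSpace ℝ (Fin M) × EuclideanSpace ℝ (Fin M) :=
  schemeState (gibbsGradient v.channel (v.smoothing n)) (1 + 1 / v.smoothing n)
    (radius M v.floor) v.start k

/-- The point `y_k` of the fast gradient scheme run with the closed-form gradients. -/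
noncomputable def gradientStep (v : Data N M) (n k : ℕ) : EuclideanSpace ℝ (Fin M) :=
  schemeY (gibbsGradient v.channel (v.smoothing n)) (1 + 1 / v.smoothing n)
    (radius M v.floor) v.start k

/-- The contribution to `p̂` of the first `k` query points. -/
noncomputable def average (v : Data N M) (n k : ℕ) : Fin N → ℝ :=
  ∑ i ∈ Finset.range k, (2 * ((i : ℝ) + 1) / (((n : ℝ) + 1) * ((n : ℝ) + 2))) •
    inputGibbs v.channel (v.smoothing n) (v.state n i).1

/-- The quantities that are computed once, before the iteration. -/
def constants (N M n : ℕ) : Set (Data N M → ℝ) :=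
  (Set.range fun (ij : Fin N × Fin M) (v : Data N M) => v.channel ij.1 ij.2) ∪
    (coordinates fun v : Data N M => condEntropy v.channel) ∪
    {fun _ => Real.log 2} ∪ {fun v => v.smoothing n} ∪ {fun v => radius M v.floor}

theorem constants_subset_iff {A : Set (Data N M → ℝ)} {n : ℕ} : constants N M n ⊆ A ↔
    (∀ i j, (fun v : Data N M => v.channel i j) ∈ A) ∧
      (∀ i, (fun v : Data N M => condEntropy v.channel i) ∈ A) ∧
      (fun _ : Data N M => Real.log 2) ∈ A ∧ (fun v : Data N M => v.smoothing n) ∈ A ∧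
      (fun v : Data N M => radius M v.floor) ∈ A := by
  simp only [constants, Set.union_subset_iff, coordinates_subset_iff, Set.range_subset_iff,
    Set.singleton_subset_iff, Prod.forall, and_assoc]

/-- The values carried from one iteration to the next. -/
def iterates (N M n k : ℕ) : Set (Data N M → ℝ) :=
  (coordinates fun (v : Data N M) j => (v.state n k).1 j) ∪
    (coordinates fun (v : Data N M) j => (v.state n k).2 j) ∪
    (coordinates fun v : Data N M => v.average n k)

theorem iterates_subset_iff {A : Set (Data N M → ℝ)} {n k : ℕ} : iterates N M n k ⊆ A ↔
    (∀ j, (fun v : Data N M => (v.state n k).1 j) ∈ A) ∧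
      (∀ j, (fun v : Data N M => (v.state n k).2 j) ∈ A) ∧
      ∀ i, (fun v : Data N M => v.average n k i) ∈ A := by
  simp only [iterates, Set.union_subset_iff, coordinates_subset_iff, and_assoc]

end Data

section Iteration

variable {A : Set (Data N M → ℝ)} {n : ℕ}

theorem computesFrom_inputGibbs (hA : Data.constants N M n ⊆ A)
    {x : Data N M → EuclideanSpace ℝ (Fin M)} (hx : ∀ j, (fun v => x v j) ∈ A) :
    ComputesFrom A (coordinates fun v : Data N M => inputGibbs v.channel (v.smoothing n) (x v))
      (2 * (M * N) + 9 * N + 1) := by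
  obtain ⟨hW, hr, hlog, hν, -⟩ := Data.constants_subset_iff.1 hA
  have hexponent : ComputesFrom A (coordinates fun (v : Data N M) i =>
      (∑ j, v.channel i j * x v j + -condEntropy v.channel i) * Real.log 2 / v.smoothing n)
      (N * (2 * M + 6)) :=
    .coordinates fun i => (((((ComputesFrom.sum fun j => (ComputesFrom.of_mem (hW i j)).mul
      (.of_mem (hx j))).add (ComputesFrom.of_mem (hr i)).neg).mul (.of_mem hlog)).div
        (.of_mem hν))).mono (by omega)
  exact (hexponent.bind fun _ _ hB => ComputesFrom.gibbs hB).mono (by linarith)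

theorem computesFrom_gibbsGradient (hA : Data.constants N M n ⊆ A)
    {x : Data N M → EuclideanSpace ℝ (Fin M)} (hx : ∀ j, (fun v => x v j) ∈ A)
    (hp : ∀ i, (fun v : Data N M => inputGibbs v.channel (v.smoothing n) (x v) i) ∈ A) :
    ComputesFrom A (coordinates fun (v : Data N M) j =>
      gibbsGradient v.channel (v.smoothing n) (x v) j) (2 * (M * N) + 8 * M + 1) := by
  obtain ⟨hW, -, hlog, -, -⟩ := Data.constants_subset_iff.1 hA
  have hexponent : ComputesFrom A (coordinates fun (v : Data N M) j => -x v j * Real.log 2)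
      (M * 3) :=
    .coordinates fun j => (ComputesFrom.of_mem (hx j)).neg.mul (.of_mem hlog)
  have hmaximizer : ComputesFrom A (coordinates fun v : Data N M => outputMaximizer (x v))
      (M * 3 + (3 * M + 1)) := hexponent.bind fun _ _ hB => ComputesFrom.gibbs hB
  refine (hmaximizer.bind (d := M * (2 * N + 2)) fun A' hA' hq => ?_).mono (by linarith)
  exact .coordinates fun j => ((ComputesFrom.sum fun i => (ComputesFrom.of_mem
    (hA' (hW i j))).mul (.of_mem (hA' (hp i)))).sub (.of_mem (hq (mem_coordinates j)))).mono
      (by omega)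

theorem computesFrom_neg_stepSize_smul (hA : Data.constants N M n ⊆ A)
    {w : Data N M → EuclideanSpace ℝ (Fin M)} (hw : ∀ j, (fun v => w v j) ∈ A) (j : Fin M) :
    ComputesFrom A {fun v : Data N M => (-((1 / (1 + 1 / v.smoothing n)) • w v)) j} 9 := by
  obtain ⟨-, -, -, hν, -⟩ := Data.constants_subset_iff.1 hA
  have hstep : ComputesFrom A {fun v : Data N M => 1 / (1 + 1 / v.smoothing n)} 6 :=
    ((ComputesFrom.const 1).div ((ComputesFrom.const 1).add ((ComputesFrom.const 1).div
      (.of_mem hν)))).congr fun v => by simp only [Nat.cast_one]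
  exact (hstep.mul (.of_mem (hw j))).neg.congr fun v => by
    simp only [PiLp.neg_apply, PiLp.smul_apply, smul_eq_mul]

theorem computesFrom_gradientStep (k : ℕ) (hA : Data.constants N M n ⊆ A)
    (hx : ∀ j, (fun v : Data N M => (v.state n k).1 j) ∈ A)
    (hg : ∀ j, (fun v : Data N M =>
      gibbsGradient v.channel (v.smoothing n) (v.state n k).1 j) ∈ A) :
    ComputesFrom A (coordinates fun (v : Data N M) j => v.gradientStep n k j) (13 * M + 4) := by
  obtain ⟨-, -, -, -, hR⟩ := Data.constants_subset_iff.1 hA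
  exact (ComputesFrom.proj hR (fun _ => radius_nonneg M _) fun j =>
    (computesFrom_neg_stepSize_smul hA hg j).add (.of_mem (hx j))).mono (by omega)

theorem computesFrom_state_succ_snd (k : ℕ)
    (ha : ∀ j, (fun v : Data N M => (v.state n k).2 j) ∈ A)
    (hg : ∀ j, (fun v : Data N M =>
      gibbsGradient v.channel (v.smoothing n) (v.state n k).1 j) ∈ A) :
    ComputesFrom A (coordinates fun (v : Data N M) j => (v.state n (k + 1)).2 j) (M * 5) :=
  .coordinates fun j => ((ComputesFrom.of_mem (ha j)).add
    (((ComputesFrom.const (k + 1)).div (.const 2)).mul (.of_mem (hg j)))).congr fun v => by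
      push_cast
      rfl

theorem computesFrom_state_succ_fst (k : ℕ) (hA : Data.constants N M n ⊆ A)
    (ha : ∀ j, (fun v : Data N M => (v.state n (k + 1)).2 j) ∈ A)
    (hy : ∀ j, (fun v : Data N M => v.gradientStep n k j) ∈ A) :
    ComputesFrom A (coordinates fun (v : Data N M) j => (v.state n (k + 1)).1 j)
      (21 * M + 4) := by
  obtain ⟨-, -, -, -, hR⟩ := Data.constants_subset_iff.1 hA
  refine ((ComputesFrom.proj hR (fun _ => radius_nonneg M _)
    (computesFrom_neg_stepSize_smul hA ha)).bind (d := M * 9) fun A' hA' hz => ?_).mono (by omega)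
  exact .coordinates fun j => ((((ComputesFrom.const 2).div (.const (k + 3))).mul
    (.of_mem (hz (mem_coordinates j)))).add
      (((ComputesFrom.const (k + 1)).div (.const (k + 3))).mul (.of_mem (hA' (hy j))))).congr
        fun v => by
          push_cast
          rfl

theorem computesFrom_average_succ (k : ℕ)
    (hs : ∀ i, (fun v : Data N M => v.average n k i) ∈ A)
    (hp : ∀ i, (fun v : Data N M =>
      inputGibbs v.channel (v.smoothing n) (v.state n k).1 i) ∈ A) :
    ComputesFrom A (coordinates fun v : Data N M => v.average n (k + 1)) (N * 9) :=
  .coordinates fun i => ((ComputesFrom.of_mem (hs i)).add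
    ((((ComputesFrom.const 2).mul (.const (k + 1))).div
      ((ComputesFrom.const (n + 1)).mul (.const (n + 2)))).mul (.of_mem (hp i)))).congr fun v => by
        simp only [Data.average, Finset.sum_range_succ, Pi.add_apply, Pi.smul_apply, smul_eq_mul]
        push_cast
        rfl

theorem computesFrom_step (hM : 0 < M) (hN : 0 < N) (k : ℕ) (hA : Data.constants N M n ⊆ A)
    (hk : Data.iterates N M n k ⊆ A) :
    ComputesFrom A (Data.iterates N M n (k + 1) ∪
      coordinates fun (v : Data N M) j => v.gradientStep n k j) (100 * (M * N)) := by
  obtain ⟨hx, ha, hs⟩ := Data.iterates_subset_iff.1 hk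
  have hcount : 2 * (M * N) + 9 * N + 1 + (2 * (M * N) + 8 * M + 1 + (M * 5 + (13 * M + 4 +
      (21 * M + 4 + N * 9)))) ≤ 100 * (M * N) := by
    have hMN : M ≤ M * N := Nat.le_mul_of_pos_right M hN
    have hNM : N ≤ M * N := Nat.le_mul_of_pos_left N hM
    linarith
  refine ComputesFrom.mono ?_ hcount
  refine (computesFrom_inputGibbs hA hx).bind fun A₁ h₁ hp => ?_
  replace hp := coordinates_subset_iff.1 hp
  refine (computesFrom_gibbsGradient (hA.trans h₁) (fun j => h₁ (hx j)) hp).bind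
    fun A₂ h₂ hg => ?_
  replace hg := coordinates_subset_iff.1 hg
  have h₀₂ := h₁.trans h₂
  refine (computesFrom_state_succ_snd k (fun j => h₀₂ (ha j)) hg).bind fun A₃ h₃ ha' => ?_
  refine (computesFrom_gradientStep k (hA.trans (h₀₂.trans h₃)) (fun j => h₃ (h₀₂ (hx j)))
    fun j => h₃ (hg j)).bind fun A₄ h₄ hy => ?_
  have h₀₄ := h₀₂.trans (h₃.trans h₄)
  refine (computesFrom_state_succ_fst k (hA.trans h₀₄)
    (coordinates_subset_iff.1 (ha'.trans h₄)) (coordinates_subset_iff.1 hy)).bind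
      fun A₅ h₅ hx' => ?_
  refine (computesFrom_average_succ k (fun i => h₅ (h₀₄ (hs i)))
    fun i => h₅ (h₄ (h₃ (h₂ (hp i))))).bind (d := 0) fun A₆ h₆ hs' => .of_subset ?_
  exact Set.union_subset (Set.union_subset (Set.union_subset (hx'.trans h₆)
    (ha'.trans (h₄.trans (h₅.trans h₆)))) hs') (hy.trans (h₅.trans h₆))

end Iteration

section Constants

variable {A : Set (Data N M → ℝ)} {n : ℕ}

theorem computesFrom_condEntropy (hW : ∀ i j, (fun v : Data N M => v.channel i j) ∈ A)
    (hlog : (fun _ : Data N M => Real.log 2) ∈ A) :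
    ComputesFrom A (coordinates fun v : Data N M => condEntropy v.channel) (N * (4 * M + 3)) :=
  .coordinates fun i => ((ComputesFrom.sum fun j => (ComputesFrom.of_mem (hW i j)).mul
    ((ComputesFrom.of_mem (hW i j)).log.div (.of_mem hlog))).neg.mono (by omega)).congr
      fun _ => rfl

theorem computesFrom_radius (hγ : (fun v : Data N M => v.floor) ∈ A)
    (hlog : (fun _ : Data N M => Real.log 2) ∈ A) :
    ComputesFrom A {fun v : Data N M => radius M v.floor} 9 :=
  ((ComputesFrom.const M).mul (((ComputesFrom.of_mem hγ).inv.log.div (.of_mem hlog)).max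
    ((ComputesFrom.const 1).div (.of_mem hlog)))).congr fun v => by
      simp only [Nat.cast_one]
      rfl

theorem computesFrom_smoothing (hγ : (fun v : Data N M => v.floor) ∈ A)
    (hlog : (fun _ : Data N M => Real.log 2) ∈ A) (n : ℕ) :
    ComputesFrom A {fun v : Data N M => v.smoothing n} 32 := by
  have hmax := ((ComputesFrom.const M).mul ((ComputesFrom.of_mem hγ).inv.log.div
    (.of_mem hlog))).max ((ComputesFrom.const 1).div (.of_mem hlog))
  have hD₁ := ((ComputesFrom.const 1).div (.const 2)).mul (hmax.mul hmax)
  have hD₂ := (ComputesFrom.const (A := A) N).log.div (.of_mem hlog)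
  refine ((((ComputesFrom.const 2).div (.const (n + 1))).mul (hD₁.div hD₂).sqrt).mono
    (by omega)).congr fun v => ?_
  simp only [Data.smoothing, smoothing, D₁, D₂, Real.logb, sq]
  push_cast
  rfl

theorem computesFrom_constants (hM : 0 < M) (hN : 0 < N) (n : ℕ) :
    ComputesFrom (Set.range fun (i : (Fin N × Fin M) ⊕ Fin M ⊕ Unit) (v : Data N M) => v i)
      (Data.constants N M n) (100 * (M * N)) := by
  have hcount : 2 + (0 + N * (4 * M + 3) + 0 + 32 + 9) ≤ 100 * (M * N) := by
    have hNM : N ≤ M * N := Nat.le_mul_of_pos_left N hM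
    linarith
  refine ComputesFrom.mono ?_ hcount
  have hlog : ComputesFrom (Set.range fun (i : (Fin N × Fin M) ⊕ Fin M ⊕ Unit)
      (v : Data N M) => v i) {fun _ => Real.log 2} 2 :=
    (ComputesFrom.const 2).log.congr fun _ => by simp only [Nat.cast_ofNat]
  refine hlog.bind fun A hA hlog => ?_
  replace hlog := hlog rfl
  have hW : ∀ i j, (fun v : Data N M => v.channel i j) ∈ A := fun i j => hA ⟨Sum.inl (i, j), rfl⟩
  have hγ : (fun v : Data N M => v.floor) ∈ A := hA ⟨Sum.inr (Sum.inr ()), rfl⟩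
  have hchannel : ComputesFrom A (Set.range fun (ij : Fin N × Fin M) (v : Data N M) =>
      v.channel ij.1 ij.2) 0 :=
    .of_subset (Set.range_subset_iff.2 fun ij => hW ij.1 ij.2)
  have hlog₀ : ComputesFrom A {fun _ : Data N M => Real.log 2} 0 := .of_mem hlog
  exact (((hchannel.union (computesFrom_condEntropy hW hlog)).union hlog₀).union
    (computesFrom_smoothing hγ hlog n)).union (computesFrom_radius hγ hlog)

end Constants

theorem computesFrom_iterates (hM : 0 < M) (hN : 0 < N) (n k : ℕ) :
    ComputesFrom ((Set.range fun (i : (Fin N × Fin M) ⊕ Fin M ⊕ Unit) (v : Data N M) => v i) ∪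
      Data.constants N M n) (Data.iterates N M n k) (100 * (M * N) * k + 1) := by
  induction k with
  | zero =>
    refine ((ComputesFrom.const 0).bind (d := 0) fun A hA hzero => .of_subset ?_).mono (by omega)
    replace hzero : (fun _ : Data N M => (0 : ℝ)) ∈ A := hzero (by simp)
    refine Data.iterates_subset_iff.2 ⟨fun j => hA (Or.inl ⟨Sum.inr (Sum.inl j), rfl⟩),
      fun _ => hzero, fun _ => ?_⟩
    simpa [Data.average] using hzero
  | succ k ih =>
    exact (ih.bind fun A hA hk => (computesFrom_step hM hN k (Set.subset_union_right.trans hA)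
      hk).subset_right Set.subset_union_left).mono (by linarith)

theorem computesFrom_output (hM : 0 < M) (hN : 0 < N) (n : ℕ) :
    ComputesFrom (Set.range fun (i : (Fin N × Fin M) ⊕ Fin M ⊕ Unit) (v : Data N M) => v i)
      (coordinates (fun (v : Data N M) j => v.gradientStep n n j) ∪
        coordinates fun v : Data N M => v.average n (n + 1)) (300 * (M * N * (n + 1))) := by
  have hprogram := (computesFrom_constants hM hN n).bind fun A₁ h₁ hconst =>
    ((computesFrom_iterates hM hN n n).subset_left (Set.union_subset h₁ hconst)).bind
      fun A₂ h₂ hiter => computesFrom_step hM hN n (hconst.trans h₂) hiter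
  have hMN : 0 < M * N := Nat.mul_pos hM hN
  exact (hprogram.subset_right (Set.union_subset Set.subset_union_right
    (Set.subset_union_right.trans Set.subset_union_left))).mono (by nlinarith)

theorem exists_runsInOps (hM : 0 < M) (hN : 2 ≤ N) (n : ℕ) :
    ∃ k : ℕ, (k : ℝ) ≤ 300 * (M * N * ((n : ℝ) + 1)) ∧ RunsInOps N M n k := by
  have hN₀ : 0 < N := by omega
  obtain ⟨k, S, hk, hS, -, hsub⟩ := computesFrom_output hM hN₀ n 0 _ .inputs subset_rfl
  refine ⟨k, by exact_mod_cast hk.trans_eq (zero_add _), S, hS,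
    fun j v => Data.gradientStep v n n j, fun i v => Data.average v n (n + 1) i,
    fun j => hsub (Or.inl (mem_coordinates j)), fun i => hsub (Or.inr (mem_coordinates i)),
    fun W γ x₀ hW _ _ _ => ?_⟩
  have hν := smoothing_pos hN M γ n
  have hgradient := smoothGradient_none hN₀ hM hW hν
  refine ⟨fun j => ?_, fun i => ?_⟩
  · rw [lamHat, hgradient]
    rfl
  · simp only [pHat, queryPoint, hgradient, smoothMaximizer_none hN₀ W hν]
    rfl

end Program

/-! ### The number of operations for accuracy `ε` -/

section Complexity

variable {N M : ℕ} {γ ε : ℝ}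

theorem one_le_radius (hM : 0 < M) (γ : ℝ) : 1 ≤ radius M γ := by
  have hM_one : (1 : ℝ) ≤ M := by exact_mod_cast hM
  have hlog : 1 ≤ 1 / Real.log 2 := by
    rw [le_div_iff₀ (Real.log_pos one_lt_two)]
    linarith [Real.log_two_lt_d9]
  exact one_le_mul_of_one_le_of_one_le hM_one (hlog.trans (le_max_right _ _))

theorem D₁_le_radius_sq (hM : 0 < M) (γ : ℝ) : D₁ M γ ≤ radius M γ ^ 2 := by
  have hM_one : (1 : ℝ) ≤ M := by exact_mod_cast hM
  have hlog : 0 ≤ 1 / Real.log 2 := by positivity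
  have hnonneg : 0 ≤ max (M * Real.logb 2 γ⁻¹) (1 / Real.log 2) := le_max_of_le_right hlog
  have hle : max (M * Real.logb 2 γ⁻¹) (1 / Real.log 2) ≤ radius M γ := by
    rw [radius, mul_max_of_nonneg _ _ M.cast_nonneg]
    exact max_le_max le_rfl (le_mul_of_one_le_left hlog hM_one)
  rw [D₁]
  linarith [pow_le_pow_left₀ hnonneg hle 2, sq_nonneg (max (M * Real.logb 2 γ⁻¹) (1 / Real.log 2))]

theorem iterationBound_add_one_le (hM : 0 < M) (hN : 2 ≤ N) (hε : 0 < ε) (hε₁ : ε ≤ 1) :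
    iterationBound N M γ ε + 1 ≤ 7 * (radius M γ * √(D₂ N) / ε) := by
  have hR := one_le_radius hM γ
  have hD₂ : 1 ≤ √(D₂ N) := Real.one_le_sqrt.2 (one_le_D₂ hN)
  have hD₁ := D₁_le_radius_sq hM γ
  have hfirst : √(D₁ M γ * D₂ N) * (1 / ε) ≤ radius M γ * √(D₂ N) / ε := by
    rw [Real.sqrt_mul (D₁_pos M γ).le, mul_one_div]
    gcongr
    exact Real.sqrt_le_iff.2 ⟨by linarith, hD₁⟩
  have hsecond : √(D₁ M γ / ε) ≤ radius M γ * √(D₂ N) / ε := by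
    refine Real.sqrt_le_iff.2 ⟨by positivity, ?_⟩
    calc D₁ M γ / ε ≤ (radius M γ * √(D₂ N)) ^ 2 / ε ^ 2 := by
          gcongr
          · exact hD₁.trans (pow_le_pow_left₀ (by linarith)
              (le_mul_of_one_le_right (by linarith) hD₂) 2)
          · exact pow_le_of_le_one hε.le hε₁ two_ne_zero
      _ = (radius M γ * √(D₂ N) / ε) ^ 2 := (div_pow _ _ 2).symm
  have hone : 1 ≤ radius M γ * √(D₂ N) / ε :=
    (one_le_div hε).2 (hε₁.trans (one_le_mul_of_one_le_of_one_le hR hD₂))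
  rw [iterationBound]
  linarith

theorem exists_runsInOps_floor (hM : 0 < M) (hN : 2 ≤ N) (hε : 0 < ε) (hε₁ : ε ≤ 1) :
    ∃ k : ℕ, (k : ℝ) ≤ 2100 * max (Real.logb 2 γ⁻¹) (1 / Real.log 2) *
        ((M : ℝ) ^ 2 * N * √(Real.logb 2 N) / ε) ∧
      RunsInOps N M ⌊iterationBound N M γ ε⌋₊ k := by
  obtain ⟨k, hk, hrun⟩ := exists_runsInOps hM hN ⌊iterationBound N M γ ε⌋₊
  refine ⟨k, ?_, hrun⟩
  have hiter : (⌊iterationBound N M γ ε⌋₊ : ℝ) + 1 ≤ 7 * (radius M γ * √(D₂ N) / ε) := by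
    linarith [Nat.floor_le (iterationBound_nonneg N M γ hε),
      iterationBound_add_one_le (γ := γ) hM hN hε hε₁]
  calc (k : ℝ) ≤ 300 * (M * N * (7 * (radius M γ * √(D₂ N) / ε))) := hk.trans (by gcongr)
    _ = _ := by
      rw [radius, D₂]
      ring

end Complexity

end DMC

theorem mainTheorem9 :
    (∀ (N M : ℕ) (W : Matrix (Fin N) (Fin M) ℝ) (γ : ℝ) (c : Option ((Fin N → ℝ) × ℝ)),
      2 ≤ N → DMC.IsChannel W → 0 < γ → (∀ i j, γ ≤ W i j) → (DMC.feasible c).Nonempty →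
      (∀ (n : ℕ), ∀ x₀ ∈ DMC.Q M γ,
        DMC.lamHat W c γ x₀ n ∈ DMC.Q M γ ∧
        DMC.pHat W c γ x₀ n ∈ stdSimplex ℝ (Fin N) ∧
        DMC.pHat W c γ x₀ n ∈ DMC.feasible c ∧
        0 ≤ DMC.F (DMC.lamHat W c γ x₀ n) + DMC.G W c (DMC.lamHat W c γ x₀ n)
            - DMC.mutualInfo (DMC.pHat W c γ x₀ n) W ∧
        DMC.F (DMC.lamHat W c γ x₀ n) + DMC.G W c (DMC.lamHat W c γ x₀ n)
            - DMC.mutualInfo (DMC.pHat W c γ x₀ n) W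
          ≤ 4 / ((n : ℝ) + 1) * √(DMC.D₁ M γ * DMC.D₂ N) + 4 * DMC.D₁ M γ / ((n : ℝ) + 1) ^ 2) ∧
      (∀ ε : ℝ, 0 < ε → ∃ n₀ : ℕ, (n₀ : ℝ) ≤ DMC.iterationBound N M γ ε ∧
        ∀ n ≥ n₀, ∀ x₀ ∈ DMC.Q M γ,
          DMC.IsEpsSolution W c ε (DMC.lamHat W c γ x₀ n) (DMC.pHat W c γ x₀ n))) ∧
    (∃ C : ℝ, 0 < C ∧ ∀ N M : ℕ, 2 ≤ N → 1 ≤ M →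
      (∀ n : ℕ, ∃ k : ℕ, (k : ℝ) ≤ C * (M * N * ((n : ℝ) + 1)) ∧ DMC.RunsInOps N M n k) ∧
      (∀ γ ε : ℝ, 0 < γ → 0 < ε → ε ≤ 1 →
        ∃ n k : ℕ, (n : ℝ) ≤ DMC.iterationBound N M γ ε ∧
          (k : ℝ) ≤ C * max (Real.logb 2 γ⁻¹) (1 / Real.log 2)
            * ((M : ℝ) ^ 2 * N * √(Real.logb 2 N) / ε) ∧
          DMC.RunsInOps N M n k ∧
          ∀ (W : Matrix (Fin N) (Fin M) ℝ), DMC.IsChannel W → (∀ i j, γ ≤ W i j) →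
            ∀ x₀ ∈ DMC.Q M γ,
              DMC.IsEpsSolution W none ε (DMC.lamHat W none γ x₀ n) (DMC.pHat W none γ x₀ n))) := by
  refine ⟨fun N M W γ c hN hW hpos hγ hc => ⟨fun n x₀ hx₀ => ?_, fun ε hε => ?_⟩,
    2100, by norm_num, fun N M hN hM => ⟨fun n => ?_, fun γ ε hpos hε hε₁ => ?_⟩⟩
  · have hp := DMC.pHat_mem_feasible W hc γ x₀ n
    exact ⟨DMC.lamHat_mem_Q W c γ x₀ n, DMC.feasible_subset c hp, hp,
      sub_nonneg.2 (DMC.mutualInfo_le_dual hW hpos hγ hp _), DMC.gap_le hN hW hpos hγ hc n hx₀⟩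
  · exact ⟨⌊DMC.iterationBound N M γ ε⌋₊, Nat.floor_le (DMC.iterationBound_nonneg N M γ hε),
      fun n hn x₀ hx₀ => DMC.isEpsSolution_of_floor_le hN hW hpos hγ hc hε hn hx₀⟩
  · obtain ⟨k, hk, hrun⟩ := DMC.exists_runsInOps hM hN n
    exact ⟨k, hk.trans (by gcongr; norm_num), hrun⟩
  · obtain ⟨k, hk, hrun⟩ := DMC.exists_runsInOps_floor (γ := γ) hM hN hε hε₁
    have hnonempty : (DMC.feasible (N := N) none).Nonempty :=
      ⟨_, DMC.gibbs_mem_stdSimplex (by omega) 0⟩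
    exact ⟨_, k, Nat.floor_le (DMC.iterationBound_nonneg N M γ hε), hk, hrun, fun W hW hγ x₀ hx₀ =>
      DMC.isEpsSolution_of_floor_le hN hW hpos hγ hnonempty hε le_rfl hx₀⟩
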